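/- Let $X=\mathbb{C}^d$ be a finite-dimensional quantum system with its canonical basis, a Hermitian Hamiltonian $H_X$, and a fixed inverse temperature $\beta>0$. For $n\in\mathbb{N}$ let $H_{X^n}=\sum_{i=1}^n H_{X_i}$ be the total Hamiltonian of $n$ copies, and let $S^{E}_{X^n}$ be the projector onto its eigenspace for the eigenvalue $E$. For a Young diagram $\lambda$ with $n$ boxes and row lengths $\lambda_i$, let $\Pi^\lambda_{X^n}$ be the orthogonal projector onto the Schur--Weyl block of $X^n=(\mathbb{C}^d)^{\otimes n}$ labeled by $\lambda$, and let $S(\lambda/n)=-\sum_i (\lambda_i/n)\log(\lambda_i/n)$. Let $R\simeq X$, let $|\Phi\rangle_{X^n:R^n}=\sum_j |j\rangle_{X^n}\otimes|j\rangle_{R^n}$ with respect to the canonical product bases, write $\Phi_{X^n:R^n}=|\Phi\rangle\langle\Phi|_{X^n:R^n}$, and let ${}^t$ be the transpose in the canonical basis. For real $w$ put $$\hat P^{(w)}_{X^nR^n}=\sum_{\substack{k,\ell,\lambda,\mu:\\ E_\ell-\beta^{-1}S(\mu/n)-E_k+\beta^{-1}S(\lambda/n)=w}} \bigl(S^{E_\ell}_{X^n}\Pi^{\mu}_{X^n}\bigr)\otimes\bigl(S^{E_k}_{X^n}\Pi^{\lambda}_{X^n}\bigr)^t_{R^n},$$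 where $E_k,E_\ell$ range over the distinct eigenvalues of $H_{X^n}$ and $\lambda,\mu$ over the Young diagrams with $n$ boxes. For a quantum channel (completely positive, trace-preserving map) $\mathcal{E}_{X\to X}$, the work-cost-dephased map $\widetilde{\mathcal{E}}_{X^n\to X^n}$ of $\mathcal{E}^{\otimes n}$ is the linear map defined by its Choi matrix $$\widetilde{\mathcal{E}}_{X^n\to X^n}(\Phi_{X^n:R^n})=\sum_{w}\hat P^{(w)}_{X^nR^n}\,\mathcal{E}^{\otimes n}(\Phi_{X^n:R^n})\,\hat P^{(w)}_{X^nR^n},$$ the sum being over the finitely many attained values $w$. Proposition. Suppose that $\mathcal{E}$ is time-covariant, i.e. $\mathcal{E}(e^{-iH_Xt}(\cdot)e^{iH_Xt})=e^{-iH_Xt}\mathcal{E}(\cdot)e^{iH_Xt}$ for all $t\in\mathbb{R}$. Let $\sigma_{X^n}$ be any quantum state on $X^n$ that is time-covariant, i.e. $e^{-iH_{X^n}t}\sigma_{X^n}e^{iH_{X^n}t}=\sigma_{X^n}$ for all $t\in\mathbb{R}$, and permutation-invariant, i.e. $U_\pi\sigma_{X^n}U_\pi^\dagger=\sigma_{X^n}$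 for every permutation $\pi$ of the $n$ copies, where $U_\pi$ is the unitary that permutes the tensor factors. Then $$\widetilde{\mathcal{E}}_{X^n\to X^n}(\sigma_{X^n})=\mathcal{E}^{\otimes n}(\sigma_{X^n}).$$ -/

import Mathlib

open scoped Matrix Kronecker ComplexOrder

noncomputable section

namespace WorkCostDephasing

variable {d : Type*} [Fintype d] [DecidableEq d]

/-! ### States, channels, time evolution

The system `X` is `ℂ^d` with its canonical basis indexed by the finite type `d`, and `X^n` has the
canonical basis indexed by `Fin n → d`. Operators are matrices in these bases. -/

/-- Density matrices. -/
def IsState {ι : Type*} [Fintype ι] (ρ : Matrix ι ι ℂ) : Prop :=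
  ρ.PosSemidef ∧ ρ.trace = 1

/-- The map `F ⊗ id` applied to an operator on the system tensored with a `k`-dimensional one. -/
def ampliate {ι κ : Type*} (k : ℕ) (F : Matrix ι ι ℂ →ₗ[ℂ] Matrix κ κ ℂ)
    (M : Matrix (ι × Fin k) (ι × Fin k) ℂ) : Matrix (κ × Fin k) (κ × Fin k) ℂ :=
  Matrix.of fun p q => F (Matrix.of fun a b => M (a, p.2) (b, q.2)) p.1 q.1

/-- Completely positive, trace-preserving maps. -/
structure IsQuantumChannel {ι κ : Type*} [Fintype ι] [Fintype κ]
    (F : Matrix ι ι ℂ →ₗ[ℂ] Matrix κ κ ℂ) : Prop where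
  completelyPositive : ∀ (k : ℕ) (M : Matrix (ι × Fin k) (ι × Fin k) ℂ),
    M.PosSemidef → (ampliate k F M).PosSemidef
  tracePreserving : ∀ M, (F M).trace = M.trace

/-- `e^{-iHt} M e^{iHt}`. -/
def evolve {ι : Type*} [Fintype ι] [DecidableEq ι] (H : Matrix ι ι ℂ) (t : ℝ)
    (M : Matrix ι ι ℂ) : Matrix ι ι ℂ :=
  NormedSpace.exp ((-(Complex.I * (t : ℂ))) • H) * M * NormedSpace.exp ((Complex.I * (t : ℂ)) • H)

/-- The channel commutes with the time evolution generated by `H`. -/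
def IsTimeCovariantChannel {ι : Type*} [Fintype ι] [DecidableEq ι] (H : Matrix ι ι ℂ)
    (F : Matrix ι ι ℂ →ₗ[ℂ] Matrix ι ι ℂ) : Prop :=
  ∀ (t : ℝ) (M : Matrix ι ι ℂ), F (evolve H t M) = evolve H t (F M)

/-- The state is invariant under the time evolution generated by `H`. -/
def IsTimeCovariantState {ι : Type*} [Fintype ι] [DecidableEq ι] (H : Matrix ι ι ℂ)
    (ρ : Matrix ι ι ℂ) : Prop :=
  ∀ t : ℝ, evolve H t ρ = ρ

/-! ### The `n`-copy system -/

/-- The total Hamiltonian `∑ i, H_{X_i}`, with `H_{X_i}` acting as `H` on the `i`-th copy and as the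
identity on all other copies. -/
def totalHamiltonian (n : ℕ) (H : Matrix d d ℂ) : Matrix (Fin n → d) (Fin n → d) ℂ :=
  ∑ i, Matrix.of fun a b => if ∀ j, j ≠ i → a j = b j then H (a i) (b i) else 0

/-- The unitary permuting the copies: `|x_1, …, x_n⟩ ↦ |x_{π⁻¹(1)}, …, x_{π⁻¹(n)}⟩`. -/
def permUnitary (d : Type*) [DecidableEq d] {n : ℕ} (π : Equiv.Perm (Fin n)) :
    Matrix (Fin n → d) (Fin n → d) ℂ :=
  Matrix.of fun a b => if a = b ∘ π.symm then 1 else 0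

/-- Invariance under all permutations of the copies. -/
def IsPermutationInvariant {n : ℕ} (ρ : Matrix (Fin n → d) (Fin n → d) ℂ) : Prop :=
  ∀ π : Equiv.Perm (Fin n), permUnitary d π * ρ * (permUnitary d π)ᴴ = ρ

/-- `F^{⊗ n}`, by linearity from its values `F(|c_1⟩⟨e_1|) ⊗ ⋯ ⊗ F(|c_n⟩⟨e_n|)` on matrix units. -/
def tensorPower (n : ℕ) (F : Matrix d d ℂ →ₗ[ℂ] Matrix d d ℂ) :
    Matrix (Fin n → d) (Fin n → d) ℂ →ₗ[ℂ] Matrix (Fin n → d) (Fin n → d) ℂ where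
  toFun M := Matrix.of fun a b =>
    ∑ c, ∑ e, M c e * ∏ i, F (Matrix.single (c i) (e i) 1) (a i) (b i)
  map_add' M N := by
    ext a b
    simp [add_mul, Finset.sum_add_distrib]
  map_smul' z M := by
    ext a b
    simp [mul_assoc, Finset.mul_sum]

/-! ### Choi matrices -/

/-- The Choi matrix `F_X(Φ_{X:R})`, where `|Φ⟩ = ∑ j, |j⟩_X ⊗ |j⟩_R`, that is
`∑ r s, F(|r⟩⟨s|) ⊗ |r⟩⟨s|`. -/
def choiMatrix {ι : Type*} [DecidableEq ι] (F : Matrix ι ι ℂ →ₗ[ℂ] Matrix ι ι ℂ) :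
    Matrix (ι × ι) (ι × ι) ℂ :=
  Matrix.of fun p q => F (Matrix.single p.2 q.2 1) p.1 q.1

/-- The linear map with a given Choi matrix. -/
def mapOfChoi {ι : Type*} [Fintype ι] (C : Matrix (ι × ι) (ι × ι) ℂ) :
    Matrix ι ι ℂ →ₗ[ℂ] Matrix ι ι ℂ where
  toFun M := Matrix.of fun a b => ∑ r, ∑ s, C (a, r) (b, s) * M r s
  map_add' M N := by
    ext a b
    simp [mul_add, Finset.sum_add_distrib]
  map_smul' z M := by
    ext a b
    simp only [Matrix.of_apply, Matrix.smul_apply, smul_eq_mul, RingHom.id_apply, Finset.mul_sum]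
    exact Finset.sum_congr rfl fun r _ => Finset.sum_congr rfl fun s _ => by ring

theorem choiMatrix_mapOfChoi {ι : Type*} [Fintype ι] [DecidableEq ι]
    (C : Matrix (ι × ι) (ι × ι) ℂ) : choiMatrix (mapOfChoi C) = C := by
  ext ⟨a, r⟩ ⟨b, s⟩
  simp [choiMatrix, mapOfChoi, Matrix.single_apply, ite_and]

theorem mapOfChoi_choiMatrix {ι : Type*} [Fintype ι] [DecidableEq ι]
    (F : Matrix ι ι ℂ →ₗ[ℂ] Matrix ι ι ℂ) : mapOfChoi (choiMatrix F) = F := by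
  refine Matrix.ext_linearMap _ fun i j => LinearMap.ext fun z => ?_
  ext a b
  have h : (Matrix.single i j z : Matrix ι ι ℂ) = z • Matrix.single i j 1 := by simp
  simp only [LinearMap.comp_apply, Matrix.singleLinearMap_apply]
  rw [h, map_smul, map_smul]
  simp [choiMatrix, mapOfChoi, Matrix.single_apply, ite_and]

/-! ### Spectral and Schur–Weyl projectors -/

/-- The orthogonal projector onto a subspace of `ℂ^ι`, as a matrix. -/
def orthogonalProjector {ι : Type*} [Fintype ι] [DecidableEq ι]
    (K : Submodule ℂ (EuclideanSpace ℂ ι)) : Matrix ι ι ℂ :=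
  (Matrix.toEuclideanCLM (n := ι) (𝕜 := ℂ)).symm K.starProjection

/-- The finite set of (real) eigenvalues `E_k` of the Hamiltonian of `X^n`. -/
def energies (n : ℕ) (H : Matrix d d ℂ) : Finset ℝ :=
  (totalHamiltonian n H).finite_real_spectrum.toFinset

/-- The projector `S_{X^n}^E` onto the eigenspace with eigenvalue `E` of the Hamiltonian of `X^n`. -/
def energyProjector (n : ℕ) (H : Matrix d d ℂ) (E : ℝ) : Matrix (Fin n → d) (Fin n → d) ℂ :=
  orthogonalProjector
    (Module.End.eigenspace (Matrix.toEuclideanLin (totalHamiltonian n H)) (E : ℂ))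

/-- The Young diagram whose rows are the parts of a partition, in decreasing order. Partitions of `n`
index the Young diagrams with `n` boxes. -/
def youngDiagram {n : ℕ} (lam : n.Partition) : YoungDiagram :=
  YoungDiagram.ofRowLens (lam.parts.sort (· ≥ ·)) (Multiset.pairwise_sort _ _).sortedGE

/-- Young tableaux of shape `lam`: bijective fillings of the boxes with the labels of the copies. -/
abbrev Tableau {n : ℕ} (lam : n.Partition) : Type := Fin n ≃ (youngDiagram lam).cells

open Classical in
/-- The row symmetrizer of a tableau, acting on `X^n`. -/
def rowSymmetrizer (d : Type*) [DecidableEq d] {n : ℕ} {lam : n.Partition} (T : Tableau lam) :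
    Matrix (Fin n → d) (Fin n → d) ℂ :=
  ∑ π : Equiv.Perm (Fin n) with ∀ i, (T (π i)).1.1 = (T i).1.1, permUnitary d π

open Classical in
/-- The column antisymmetrizer of a tableau, acting on `X^n`. -/
def columnAntisymmetrizer (d : Type*) [DecidableEq d] {n : ℕ} {lam : n.Partition}
    (T : Tableau lam) : Matrix (Fin n → d) (Fin n → d) ℂ :=
  ∑ π : Equiv.Perm (Fin n) with ∀ i, (T (π i)).1.2 = (T i).1.2,
    ((Equiv.Perm.sign π : ℤ) : ℂ) • permUnitary d π

/-- The Young symmetrizer of a tableau, acting on `X^n`. Its image is either zero or a copy of the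
irreducible polynomial representation of `GL(d)` with highest weight `lam`. -/
def youngSymmetrizer (d : Type*) [Fintype d] [DecidableEq d] {n : ℕ} {lam : n.Partition}
    (T : Tableau lam) : Matrix (Fin n → d) (Fin n → d) ℂ :=
  rowSymmetrizer d T * columnAntisymmetrizer d T

/-- The Schur–Weyl block of `X^n` labeled by `lam`, i.e. the sum of all the copies of the irreducible
representation of `GL(d)` with highest weight `lam`: the span of the images of all Young symmetrizers
of shape `lam`. -/
def schurWeylBlock (d : Type*) [Fintype d] [DecidableEq d] {n : ℕ} (lam : n.Partition) :
    Submodule ℂ (EuclideanSpace ℂ (Fin n → d)) :=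
  ⨆ T : Tableau lam, LinearMap.range (Matrix.toEuclideanLin (youngSymmetrizer d T))

/-- The projector `Π_{X^n}^lam` onto the Schur–Weyl block labeled by `lam`. -/
def schurWeylProjector (d : Type*) [Fintype d] [DecidableEq d] {n : ℕ} (lam : n.Partition) :
    Matrix (Fin n → d) (Fin n → d) ℂ :=
  orthogonalProjector (schurWeylBlock d lam)

/-- The Shannon entropy `S(lam / n) = -∑ i, (lam_i / n) log (lam_i / n)`. -/
def partitionEntropy {n : ℕ} (lam : n.Partition) : ℝ :=
  (lam.parts.map fun p => Real.negMulLog ((p : ℝ) / (n : ℝ))).sum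

/-! ### The work-cost-dephased channel -/

/-- Labels of joint outcomes on one copy of `X^n`: an energy and a Young diagram. -/
def outcomes (n : ℕ) (H : Matrix d d ℂ) : Finset (ℝ × n.Partition) :=
  energies n H ×ˢ Finset.univ

/-- The operator `S_{X^n}^E Π_{X^n}^lam`. -/
def outcomeProjector (n : ℕ) (H : Matrix d d ℂ) (o : ℝ × n.Partition) :
    Matrix (Fin n → d) (Fin n → d) ℂ :=
  energyProjector n H o.1 * schurWeylProjector d o.2

/-- The free energy estimate `E - β⁻¹ S(lam / n)`. -/
def freeEnergyEstimate {n : ℕ} (β : ℝ) (o : ℝ × n.Partition) : ℝ :=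
  o.1 - β⁻¹ * partitionEntropy o.2

/-- The work value of the output label `x.1 = (E_ℓ, μ)` and the input label `x.2 = (E_k, lam)`. -/
def workValue {n : ℕ} (β : ℝ) (x : (ℝ × n.Partition) × (ℝ × n.Partition)) : ℝ :=
  freeEnergyEstimate β x.1 - freeEnergyEstimate β x.2

/-- The finite set of all work values attained by the labels. -/
def workValues (n : ℕ) (β : ℝ) (H : Matrix d d ℂ) : Finset ℝ :=
  (outcomes n H ×ˢ outcomes n H).image (workValue β)

/-- The operator `P̂^(w)` on `X^n R^n`, the sum of
`(S^{E_ℓ} Π^μ)_{X^n} ⊗ (S^{E_k} Π^lam)ᵗ_{R^n}` over all labels with work value `w`. -/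
def workProjector (n : ℕ) (β : ℝ) (H : Matrix d d ℂ) (w : ℝ) :
    Matrix ((Fin n → d) × (Fin n → d)) ((Fin n → d) × (Fin n → d)) ℂ :=
  ∑ x ∈ outcomes n H ×ˢ outcomes n H with workValue β x = w,
    outcomeProjector n H x.1 ⊗ₖ (outcomeProjector n H x.2)ᵀ

/-- The work-cost-dephased map of `F^{⊗ n}`: the linear map with Choi matrix
`∑ w, P̂^(w) F^{⊗ n}(Φ_{X^n : R^n}) P̂^(w)`. -/
def workCostDephased (n : ℕ) (β : ℝ) (H : Matrix d d ℂ) (F : Matrix d d ℂ →ₗ[ℂ] Matrix d d ℂ) :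
    Matrix (Fin n → d) (Fin n → d) ℂ →ₗ[ℂ] Matrix (Fin n → d) (Fin n → d) ℂ :=
  mapOfChoi (∑ w ∈ workValues n β H,
    workProjector n β H w * choiMatrix (tensorPower n F) * workProjector n β H w)

theorem choiMatrix_workCostDephased (n : ℕ) (β : ℝ) (H : Matrix d d ℂ)
    (F : Matrix d d ℂ →ₗ[ℂ] Matrix d d ℂ) :
    choiMatrix (workCostDephased n β H F) = ∑ w ∈ workValues n β H,
      workProjector n β H w * choiMatrix (tensorPower n F) * workProjector n β H w :=
  choiMatrix_mapOfChoi _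

end WorkCostDephasing

end

/-!
The outcome operators `Q_o = S^E Π^lam`, `o = (E, lam)`, form a projective measurement, and in
terms of them the dephased map sends `σ` to the sum of `Q_p F^{⊗ n}(Q_o σ Q_{o'}) Q_{p'}` over
labels for which `(p, o)` and `(p', o')` have the same work value (`workCostDephased_apply`). If
`σ` commutes with the total Hamiltonian and with all permutations of the copies, it commutes with
all `Q_o`, so only the terms with `o = o'` survive. Then `F^{⊗ n}(Q_o σ)` has the same two
symmetries, since `F^{⊗ n}` is covariant under both, so only `p = p'` survives. The condition on
the work values is then automatic, and the remaining sum of `Q_p F^{⊗ n}(Q_o σ)` over all `p` and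
`o` is `F^{⊗ n}(σ)`.

Time covariance is used in differentiated form: the evolution has derivative `-i [H, ·]` at time
zero, so an invariant state commutes with the Hamiltonian, `F` commutes with `[H, ·]`, and
`F^{⊗ n}` commutes with the commutator with the total Hamiltonian by the Leibniz rule.

That the `Π^lam` form a projective measurement is proved in the real group algebra of the
symmetric group. If the shape of `T` is not dominated by that of `T'`, some two labels share a
row of `T` and a column of `T'`, whence `R_T x C_{T'} = 0` and `C_{T'} x R_T = 0` for all `x`.
This makes the blocks of different shapes orthogonal (`schurWeylBlock_isOrtho`). It also makes
the central elements `z_lam = ∑ T, R_T C_T R_T` annihilate each other, while `z_lam ^ 2 ≠ 0`, so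
they are linearly independent. There are as many of them as conjugacy classes, hence they span
the class functions, and `1` is a combination of the `z_lam` (`one_mem_span_blockElement`).
Letting this identity act on `X^n` shows that the blocks span everything (`iSup_schurWeylBlock`).
-/

namespace WorkCostDephasing

variable {d : Type*} [Fintype d] [DecidableEq d]

/-! ### Orthogonal projectors as matrices -/

section Projectors

variable {ι : Type*} [Fintype ι] [DecidableEq ι]

theorem orthogonalProjector_mul_self (K : Submodule ℂ (EuclideanSpace ℂ ι)) :
    orthogonalProjector K * orthogonalProjector K = orthogonalProjector K := by
  unfold orthogonalProjector
  rw [← map_mul]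
  congr 1
  exact K.isIdempotentElem_starProjection

theorem orthogonalProjector_mul_eq_zero {K L : Submodule ℂ (EuclideanSpace ℂ ι)} (h : K ⟂ L) :
    orthogonalProjector K * orthogonalProjector L = 0 := by
  unfold orthogonalProjector
  rw [← map_mul, ContinuousLinearMap.mul_def, h.starProjection_comp_starProjection, map_zero]

theorem sum_orthogonalProjector_eq_one {κ : Type*} [Fintype κ]
    {K : κ → Submodule ℂ (EuclideanSpace ℂ ι)} (hK : ∀ i j, i ≠ j → K i ⟂ K j)
    (htop : ⨆ i, K i = ⊤) : ∑ i, orthogonalProjector (K i) = 1 := by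
  have hK' : OrthogonalFamily ℂ (fun i => K i) fun i => (K i).subtypeₗᵢ :=
    OrthogonalFamily.of_pairwise fun i j hij => hK i j hij
  unfold orthogonalProjector
  rw [← map_sum, ← map_one (Matrix.toEuclideanCLM (n := ι) (𝕜 := ℂ)).symm]
  congr 1
  ext1 x
  rw [sum_apply]
  exact hK'.sum_projection_of_mem_iSup x (htop ▸ Submodule.mem_top)

/-- A matrix commutes with the orthogonal projector onto a subspace that both the matrix and its
adjoint preserve. -/
theorem commute_orthogonalProjector {K : Submodule ℂ (EuclideanSpace ℂ ι)} {B : Matrix ι ι ℂ}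
    (h : ∀ v ∈ K, Matrix.toEuclideanLin B v ∈ K) (h' : ∀ v ∈ K, Matrix.toEuclideanLin Bᴴ v ∈ K) :
    Commute (orthogonalProjector K) B := by
  have key : Commute K.starProjection (Matrix.toEuclideanCLM (n := ι) (𝕜 := ℂ) B) := by
    rw [ContinuousLinearMap.IsIdempotentElem.commute_iff K.isIdempotentElem_starProjection]
    constructor
    · rw [Submodule.range_starProjection]
      exact h
    · rw [Submodule.ker_starProjection]
      have hadj : ContinuousLinearMap.adjoint (Matrix.toEuclideanCLM (n := ι) (𝕜 := ℂ) B) =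
          Matrix.toEuclideanCLM (n := ι) (𝕜 := ℂ) Bᴴ := by
        rw [← ContinuousLinearMap.star_eq_adjoint, ← map_star, Matrix.star_eq_conjTranspose]
      refine ContinuousLinearMap.orthogonal_mem_invtSubmodule (U := K) ?_
      rw [hadj]
      exact h'
  have := key.map (Matrix.toEuclideanCLM (n := ι) (𝕜 := ℂ)).symm
  simpa [orthogonalProjector] using this

theorem range_toEuclideanLin_isOrtho {A B : Matrix ι ι ℂ} (h : Aᴴ * B = 0) :
    LinearMap.range (Matrix.toEuclideanLin A) ⟂ LinearMap.range (Matrix.toEuclideanLin B) := by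
  rw [Submodule.isOrtho_iff_inner_eq]
  rintro _ ⟨v, rfl⟩ _ ⟨w, rfl⟩
  rw [← LinearMap.adjoint_inner_right, ← Matrix.toEuclideanLin_conjTranspose_eq_adjoint]
  have : Matrix.toEuclideanLin Aᴴ (Matrix.toEuclideanLin B w) =
      Matrix.toEuclideanLin (Aᴴ * B) w := by
    ext1
    simp [Matrix.toLpLin_apply]
  rw [this, h]
  simp

end Projectors

/-! ### Energy eigenspaces -/

omit [Fintype d] in
theorem totalHamiltonian_isHermitian (n : ℕ) {H : Matrix d d ℂ} (hH : H.IsHermitian) :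
    (totalHamiltonian n H).IsHermitian := by
  unfold totalHamiltonian Matrix.IsHermitian
  rw [Matrix.conjTranspose_sum]
  refine Finset.sum_congr rfl fun i _ => ?_
  ext a b
  simp only [Matrix.conjTranspose_apply, Matrix.of_apply, eq_comm (a := b _)]
  split_ifs
  · exact hH.apply _ _
  · simp

theorem energyProjector_mul_self (n : ℕ) (H : Matrix d d ℂ) (E : ℝ) :
    energyProjector n H E * energyProjector n H E = energyProjector n H E :=
  orthogonalProjector_mul_self _

theorem energyProjector_mul_eq_zero (n : ℕ) {H : Matrix d d ℂ} (hH : H.IsHermitian) {E E' : ℝ}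
    (h : E ≠ E') : energyProjector n H E * energyProjector n H E' = 0 := by
  apply orthogonalProjector_mul_eq_zero
  have hs := Matrix.isSymmetric_toEuclideanLin_iff.2 (totalHamiltonian_isHermitian n hH)
  exact hs.orthogonalFamily_eigenspaces.isOrtho (by exact_mod_cast h)

theorem sum_energyProjector (n : ℕ) {H : Matrix d d ℂ} (hH : H.IsHermitian) :
    ∑ E ∈ energies n H, energyProjector n H E = 1 := by
  have hs := Matrix.isSymmetric_toEuclideanLin_iff.2 (totalHamiltonian_isHermitian n hH)
  rw [← Finset.sum_coe_sort]
  refine sum_orthogonalProjector_eq_one (K := fun E : energies n H =>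
    Module.End.eigenspace (Matrix.toEuclideanLin (totalHamiltonian n H)) ((E : ℝ) : ℂ)) ?_ ?_
  · intro E E' h
    refine hs.orthogonalFamily_eigenspaces.isOrtho fun h' => h (Subtype.ext ?_)
    exact_mod_cast h'
  · have htop := Submodule.orthogonal_eq_bot_iff.1 hs.orthogonalComplement_iSup_eigenspaces_eq_bot
    rw [eq_top_iff, ← htop]
    refine iSup_le fun μ => ?_
    by_cases hμ : Module.End.HasEigenvalue
      (Matrix.toEuclideanLin (totalHamiltonian n H)) μ
    · have hre : ((μ.re : ℝ) : ℂ) = μ := Complex.conj_eq_iff_re.1 (hs.conj_eigenvalue_eq_self hμ)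
      have hspec := hμ.mem_spectrum
      rw [Matrix.spectrum_toLpLin, ← hre] at hspec
      have hmem : μ.re ∈ energies n H := by
        rw [energies, Set.Finite.mem_toFinset]
        exact (spectrum.algebraMap_mem_iff ℂ).1 hspec
      refine le_iSup_of_le ⟨μ.re, hmem⟩ ?_
      simp only [hre, le_refl]
    · rw [Module.End.hasEigenvalue_iff, not_not] at hμ
      simp [hμ]

theorem commute_energyProjector (n : ℕ) {H : Matrix d d ℂ} (hH : H.IsHermitian)
    {B : Matrix (Fin n → d) (Fin n → d) ℂ} (h : Commute (totalHamiltonian n H) B) (E : ℝ) :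
    Commute (energyProjector n H E) B := by
  have key : ∀ C : Matrix (Fin n → d) (Fin n → d) ℂ, Commute (totalHamiltonian n H) C →
      ∀ v ∈ Module.End.eigenspace (Matrix.toEuclideanLin (totalHamiltonian n H)) (E : ℂ),
      Matrix.toEuclideanLin C v ∈
        Module.End.eigenspace (Matrix.toEuclideanLin (totalHamiltonian n H)) (E : ℂ) := by
    intro C hC v hv
    rw [Module.End.mem_eigenspace_iff] at hv ⊢
    rw [← map_smul, ← hv]
    ext1
    simp [Matrix.toLpLin_apply, hC.eq]
  refine commute_orthogonalProjector (key B h) (key Bᴴ ?_)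
  have := congrArg Matrix.conjTranspose h.eq
  rw [Matrix.conjTranspose_mul, Matrix.conjTranspose_mul,
    (totalHamiltonian_isHermitian n hH).eq] at this
  exact this.symm

/-! ### Young diagrams and dominance -/

theorem card_cellsOfRowLens (w : List ℕ) : (YoungDiagram.cellsOfRowLens w).card = w.sum := by
  induction w with
  | nil => rfl
  | cons a w ih =>
    rw [YoungDiagram.cellsOfRowLens, Finset.card_union_of_disjoint]
    · simp [ih]
    · rw [Finset.disjoint_left]
      rintro ⟨i, j⟩ h h'
      simp only [Finset.mem_product, Finset.mem_singleton, Finset.mem_map] at h h'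
      obtain ⟨⟨i', j'⟩, -, h'⟩ := h'
      simp only [Function.Embedding.prodMap, Function.Embedding.coeFn_mk, Prod.map,
        Prod.mk.injEq] at h'
      exact Nat.succ_ne_zero _ (h'.1.trans h.1)

theorem card_cells_youngDiagram {n : ℕ} (lam : n.Partition) :
    (youngDiagram lam).cells.card = n := by
  rw [youngDiagram, YoungDiagram.ofRowLens, card_cellsOfRowLens, ← Multiset.sum_coe,
    Multiset.sort_eq, lam.parts_sum]

instance tableau_nonempty {n : ℕ} (lam : n.Partition) : Nonempty (Tableau lam) :=
  ⟨Fintype.equivOfCardEq (by simp [card_cells_youngDiagram])⟩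

theorem youngDiagram_injective {n : ℕ} :
    Function.Injective (youngDiagram : n.Partition → YoungDiagram) := by
  intro lam mu h
  have key : ∀ nu : n.Partition, (youngDiagram nu).rowLens = nu.parts.sort (· ≥ ·) := fun nu =>
    YoungDiagram.rowLens_ofRowLens_eq_self fun x hx => nu.parts_pos ((Multiset.mem_sort _).1 hx)
  ext1
  rw [← Multiset.sort_eq lam.parts (· ≥ ·), ← key, h, key, Multiset.sort_eq]

/-- The number of boxes in the first `k` rows. -/
def headCard (D : YoungDiagram) (k : ℕ) : ℕ :=
  (D.cells.filter fun c => c.1 < k).card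

theorem headCard_succ (D : YoungDiagram) (k : ℕ) :
    headCard D (k + 1) = headCard D k + D.rowLen k := by
  rw [headCard, headCard, D.rowLen_eq_card, ← Finset.card_union_of_disjoint]
  · congr 1
    ext c
    simp only [Finset.mem_filter, Finset.mem_union, YoungDiagram.mem_row_iff,
      YoungDiagram.mem_cells, Nat.lt_succ_iff_lt_or_eq]
    tauto
  · rw [Finset.disjoint_left]
    intro c h h'
    exact (Finset.mem_filter.1 h).2.ne (YoungDiagram.mem_row_iff.1 h').2

theorem eq_of_headCard_eq {D D' : YoungDiagram} (h : ∀ k, headCard D k = headCard D' k) :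
    D = D' := by
  ext ⟨i, j⟩
  have h1 := headCard_succ D i
  have h2 := headCard_succ D' i
  rw [YoungDiagram.mem_cells, YoungDiagram.mem_cells, YoungDiagram.mem_iff_lt_rowLen,
    YoungDiagram.mem_iff_lt_rowLen]
  have := h i
  have := h (i + 1)
  omega

/-- The dominance order on Young diagrams, through the partial sums of the row lengths. -/
def Dominated (D D' : YoungDiagram) : Prop := ∀ k, headCard D k ≤ headCard D' k

/-- If every row of `T` meets every column of `T'` at most once, then the shape of `T` is dominated
by that of `T'`: each column of `T'` holds at most `k` labels from the first `k` rows of `T`. -/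
theorem dominated_of_rows_meet_columns_once {n : ℕ} {lam mu : n.Partition} (T : Tableau lam)
    (T' : Tableau mu)
    (h : ∀ i j, (T i).1.1 = (T j).1.1 → (T' i).1.2 = (T' j).1.2 → i = j) :
    Dominated (youngDiagram lam) (youngDiagram mu) := by
  intro k
  have hcard : headCard (youngDiagram lam) k =
      (Finset.univ.filter fun i : Fin n => (T i).1.1 < k).card := by
    symm
    refine Finset.card_bij (fun i _ => (T i).1) ?_ ?_ ?_
    · intro i hi
      exact Finset.mem_filter.2 ⟨(T i).2, (Finset.mem_filter.1 hi).2⟩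
    · intro i _ j _ hij
      exact T.injective (Subtype.ext hij)
    · intro c hc
      obtain ⟨hc, hk⟩ := Finset.mem_filter.1 hc
      exact ⟨T.symm ⟨c, hc⟩, by simpa using hk, by simp⟩
  rw [hcard, headCard,
    Finset.card_eq_sum_card_fiberwise (f := fun i => (T' i).1.2)
      (t := (youngDiagram mu).cells.image Prod.snd)
      fun i _ => Finset.mem_coe.2 (Finset.mem_image_of_mem _ (T' i).2),
    Finset.card_eq_sum_card_fiberwise (s := (youngDiagram mu).cells.filter _) (f := Prod.snd)
      (t := (youngDiagram mu).cells.image Prod.snd)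
      fun c hc => Finset.mem_coe.2 (Finset.mem_image_of_mem _ (Finset.mem_filter.1 hc).1)]
  refine Finset.sum_le_sum fun c _ => ?_
  have h1 : (((Finset.univ.filter fun i : Fin n => (T i).1.1 < k).filter
      fun i => (T' i).1.2 = c)).card ≤ k := by
    conv_rhs => rw [← Finset.card_range k]
    refine Finset.card_le_card_of_injOn (fun i => (T i).1.1) ?_ ?_
    · intro i hi
      simp only [Finset.coe_filter, Finset.mem_filter, Set.mem_ofPred_eq] at hi
      simpa using hi.1.2
    · intro i hi j hj hij
      simp only [Finset.coe_filter, Finset.mem_filter, Set.mem_ofPred_eq] at hi hj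
      exact h i j hij (hi.2.trans hj.2.symm)
  have h2 : (((Finset.univ.filter fun i : Fin n => (T i).1.1 < k).filter
      fun i => (T' i).1.2 = c)).card ≤ (youngDiagram mu).colLen c := by
    rw [YoungDiagram.colLen_eq_card]
    refine Finset.card_le_card_of_injOn (fun i => (T' i).1) ?_ ?_
    · intro i hi
      simp only [Finset.coe_filter, Finset.mem_filter, Set.mem_ofPred_eq] at hi
      exact YoungDiagram.mem_col_iff.2 ⟨(T' i).2, hi.2⟩
    · intro i _ j _ hij
      exact T'.injective (Subtype.ext hij)
  refine (le_min h1 h2).trans ?_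
  rw [← Finset.card_range (min k _)]
  refine Finset.card_le_card_of_injOn (fun r => (r, c)) ?_ ?_
  · intro r hr
    simp only [Finset.coe_range, Set.mem_Iio, lt_min_iff] at hr
    simp only [Finset.coe_filter, Finset.mem_filter, Set.mem_ofPred_eq, YoungDiagram.mem_cells]
    exact ⟨⟨YoungDiagram.mem_iff_lt_colLen.2 hr.2, hr.1⟩, trivial⟩
  · intro r _ s _ hrs
    exact congrArg Prod.fst hrs

/-- Dominance is antisymmetric on diagrams with `n` boxes. -/
theorem not_dominated_or_not_dominated {n : ℕ} {lam mu : n.Partition} (h : lam ≠ mu) :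
    ¬ Dominated (youngDiagram lam) (youngDiagram mu) ∨
      ¬ Dominated (youngDiagram mu) (youngDiagram lam) := by
  by_contra! h'
  exact h (youngDiagram_injective (eq_of_headCard_eq fun k => le_antisymm (h'.1 k) (h'.2 k)))

/-! ### Young symmetrizers in the group algebra -/

section GroupAlgebra

variable {n : ℕ}

local notation "𝔸" => MonoidAlgebra ℝ (Equiv.Perm (Fin n))

open MonoidAlgebra (single)

open Classical in
/-- The row symmetrizer of a tableau in the group algebra. -/
noncomputable def rowSum {lam : n.Partition} (T : Tableau lam) : 𝔸 :=
  ∑ π : Equiv.Perm (Fin n) with ∀ i, (T (π i)).1.1 = (T i).1.1, single π 1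

open Classical in
/-- The column antisymmetrizer of a tableau in the group algebra. -/
noncomputable def colSum {lam : n.Partition} (T : Tableau lam) : 𝔸 :=
  ∑ π : Equiv.Perm (Fin n) with ∀ i, (T (π i)).1.2 = (T i).1.2,
    single π ((Equiv.Perm.sign π : ℤ) : ℝ)

theorem apply_swap_eq {α : Type*} {f : Fin n → α} {i j : Fin n} (h : f i = f j) (x : Fin n) :
    f (Equiv.swap i j x) = f x := by
  rw [Equiv.swap_apply_def]
  split_ifs with h1 h2
  · rw [h1, h]
  · rw [h2, h]
  · rfl

theorem eq_zero_of_eq_neg_self {x : 𝔸} (h : x = -x) : x = 0 := by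
  ext g
  have := congrArg (fun y : 𝔸 => y.coeff g) h
  simp only [MonoidAlgebra.coeff_neg, Finsupp.neg_apply] at this
  simp only [MonoidAlgebra.coeff_zero, Finsupp.zero_apply]
  linarith

theorem rowSum_mul_swap {lam : n.Partition} (T : Tableau lam) {i j : Fin n}
    (h : (T i).1.1 = (T j).1.1) : rowSum T * single (Equiv.swap i j) 1 = rowSum T := by
  classical
  rw [rowSum, Finset.sum_mul]
  simp only [MonoidAlgebra.single_mul_single, mul_one]
  refine Finset.sum_equiv (Equiv.mulRight (Equiv.swap i j)) (fun π => ?_) fun _ _ => rfl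
  have hs := apply_swap_eq (f := fun x => (T x).1.1) h
  simp only [Finset.mem_filter, Finset.mem_univ, true_and, Equiv.coe_mulRight, Equiv.Perm.mul_apply]
  refine ⟨fun hπ x => (hπ _).trans (hs x), fun hπ x => ?_⟩
  have := hπ (Equiv.swap i j x)
  rwa [Equiv.swap_apply_self, hs] at this

theorem swap_mul_rowSum {lam : n.Partition} (T : Tableau lam) {i j : Fin n}
    (h : (T i).1.1 = (T j).1.1) : single (Equiv.swap i j) 1 * rowSum T = rowSum T := by
  classical
  rw [rowSum, Finset.mul_sum]
  simp only [MonoidAlgebra.single_mul_single, mul_one]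
  refine Finset.sum_equiv (Equiv.mulLeft (Equiv.swap i j)) (fun π => ?_) fun _ _ => rfl
  have hs := apply_swap_eq (f := fun x => (T x).1.1) h
  simp [hs]

theorem swap_mul_colSum {lam : n.Partition} (T : Tableau lam) {i j : Fin n} (hij : i ≠ j)
    (h : (T i).1.2 = (T j).1.2) : single (Equiv.swap i j) 1 * colSum T = - colSum T := by
  classical
  rw [colSum, Finset.mul_sum, ← Finset.sum_neg_distrib]
  refine Finset.sum_equiv (Equiv.mulLeft (Equiv.swap i j)) (fun π => ?_) fun π _ => ?_
  · have hs := apply_swap_eq (f := fun x => (T x).1.2) h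
    simp [hs]
  · simp [MonoidAlgebra.single_mul_single, Equiv.Perm.sign_swap hij, MonoidAlgebra.single_neg]

theorem colSum_mul_swap {lam : n.Partition} (T : Tableau lam) {i j : Fin n} (hij : i ≠ j)
    (h : (T i).1.2 = (T j).1.2) : colSum T * single (Equiv.swap i j) 1 = - colSum T := by
  classical
  rw [colSum, Finset.sum_mul, ← Finset.sum_neg_distrib]
  refine Finset.sum_equiv (Equiv.mulRight (Equiv.swap i j)) (fun π => ?_) fun π _ => ?_
  · have hs := apply_swap_eq (f := fun x => (T x).1.2) h
    simp only [Finset.mem_filter, Finset.mem_univ, true_and, Equiv.coe_mulRight,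
      Equiv.Perm.mul_apply]
    refine ⟨fun hπ x => (hπ _).trans (hs x), fun hπ x => ?_⟩
    have := hπ (Equiv.swap i j x)
    rwa [Equiv.swap_apply_self, hs] at this
  · simp [MonoidAlgebra.single_mul_single, Equiv.Perm.sign_swap hij, MonoidAlgebra.single_neg]

/-- The pigeonhole principle behind the orthogonality of different shapes, for `T` and the tableau
`T' ∘ g⁻¹`. -/
theorem exists_pair_of_not_dominated {lam mu : n.Partition}
    (h : ¬ Dominated (youngDiagram lam) (youngDiagram mu)) (T : Tableau lam) (T' : Tableau mu)
    (g : Equiv.Perm (Fin n)) :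
    ∃ i j, i ≠ j ∧ (T i).1.1 = (T j).1.1 ∧ (T' (g⁻¹ i)).1.2 = (T' (g⁻¹ j)).1.2 := by
  by_contra! hc
  refine h (dominated_of_rows_meet_columns_once T (g⁻¹.trans T') fun i j h1 h2 => ?_)
  by_contra hij
  exact hc i j hij h1 h2

/-- For the pair `i, j` in one row of `T` and one column of `T' ∘ g⁻¹`, the swap of `i` and `j` is
absorbed by the row symmetrizer, and changes the sign of the column antisymmetrizer once it has been
moved past `g`. -/
theorem rowSum_mul_mul_colSum {lam mu : n.Partition}
    (h : ¬ Dominated (youngDiagram lam) (youngDiagram mu)) (T : Tableau lam) (T' : Tableau mu)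
    (x : 𝔸) : rowSum T * x * colSum T' = 0 := by
  induction x using MonoidAlgebra.induction_linear with
  | zero => simp
  | add x y hx hy => rw [mul_add, add_mul, hx, hy, add_zero]
  | single g r =>
    obtain ⟨i, j, hij, h1, h2⟩ := exists_pair_of_not_dominated h T T' g
    have hcomm : (single (Equiv.swap i j) 1 : 𝔸) * single g r =
        single g r * single (Equiv.swap (g⁻¹ i) (g⁻¹ j)) 1 := by
      rw [MonoidAlgebra.single_mul_single, MonoidAlgebra.single_mul_single, one_mul, mul_one,
        Equiv.mul_swap_eq_swap_mul]
      simp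
    refine eq_zero_of_eq_neg_self ?_
    conv_lhs => rw [← rowSum_mul_swap T h1, mul_assoc (rowSum T), hcomm, ← mul_assoc, mul_assoc,
      swap_mul_colSum T' (by simpa using hij) h2, mul_neg]

/-- The mirror image of `rowSum_mul_mul_colSum`. -/
theorem colSum_mul_mul_rowSum {lam mu : n.Partition}
    (h : ¬ Dominated (youngDiagram lam) (youngDiagram mu)) (T : Tableau lam) (T' : Tableau mu)
    (x : 𝔸) : colSum T' * x * rowSum T = 0 := by
  induction x using MonoidAlgebra.induction_linear with
  | zero => simp
  | add x y hx hy => rw [mul_add, add_mul, hx, hy, add_zero]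
  | single g r =>
    obtain ⟨i, j, hij, h1, h2⟩ := exists_pair_of_not_dominated h T T' g⁻¹
    have hcomm : single g r * (single (Equiv.swap i j) 1 : 𝔸) =
        single (Equiv.swap (g i) (g j)) 1 * single g r := by
      rw [MonoidAlgebra.single_mul_single, MonoidAlgebra.single_mul_single, one_mul, mul_one,
        Equiv.mul_swap_eq_swap_mul]
    rw [inv_inv] at h2
    refine eq_zero_of_eq_neg_self ?_
    conv_lhs => rw [← swap_mul_rowSum T h1, ← mul_assoc, mul_assoc (colSum T'), hcomm, ← mul_assoc,
      colSum_mul_swap T' (by simpa using hij) h2, neg_mul, neg_mul]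

theorem single_mul_rowSum {lam : n.Partition} (T : Tableau lam) (g : Equiv.Perm (Fin n)) :
    single g 1 * rowSum T = rowSum (g⁻¹.trans T) * single g 1 := by
  classical
  rw [rowSum, rowSum, Finset.mul_sum, Finset.sum_mul]
  simp only [MonoidAlgebra.single_mul_single, mul_one]
  refine Finset.sum_equiv (MulAut.conj g).toEquiv (fun π => ?_) fun π _ => by simp
  simp only [Finset.mem_filter, Finset.mem_univ, true_and]
  refine ⟨fun h i => by simpa using h (g⁻¹ i), fun h i => by simpa using h (g i)⟩

theorem single_mul_colSum {lam : n.Partition} (T : Tableau lam) (g : Equiv.Perm (Fin n)) :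
    single g 1 * colSum T = colSum (g⁻¹.trans T) * single g 1 := by
  classical
  rw [colSum, colSum, Finset.mul_sum, Finset.sum_mul]
  simp only [MonoidAlgebra.single_mul_single, mul_one, one_mul]
  refine Finset.sum_equiv (MulAut.conj g).toEquiv (fun π => ?_) fun π _ => by
    simp [mul_right_comm]
  simp only [Finset.mem_filter, Finset.mem_univ, true_and]
  refine ⟨fun h i => by simpa using h (g⁻¹ i), fun h i => by simpa using h (g i)⟩

/-! ### The central elements attached to Young diagrams -/

/-- The central element `∑ T, R_T C_T R_T` of the group algebra, over all tableaux `T` of shape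
`lam`, with row symmetrizer `R_T` and column antisymmetrizer `C_T`. -/
noncomputable def blockElement (lam : n.Partition) : 𝔸 :=
  ∑ T : Tableau lam, rowSum T * colSum T * rowSum T

theorem blockElement_mul_blockElement {lam mu : n.Partition} (h : lam ≠ mu) :
    blockElement lam * blockElement mu = 0 := by
  rw [blockElement, blockElement, Finset.sum_mul_sum]
  refine Finset.sum_eq_zero fun T _ => Finset.sum_eq_zero fun T' _ => ?_
  rcases not_dominated_or_not_dominated h with h | h
  · have := rowSum_mul_mul_colSum h T T' (colSum T * rowSum T * rowSum T')
    calc _ = rowSum T * (colSum T * rowSum T * rowSum T') * colSum T' * rowSum T' := by noncomm_ring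
      _ = 0 := by rw [this, zero_mul]
  · have := colSum_mul_mul_rowSum h T' T (rowSum T * rowSum T' * colSum T')
    calc _ = rowSum T * (colSum T * (rowSum T * rowSum T' * colSum T') * rowSum T') := by
          noncomm_ring
      _ = 0 := by rw [this, mul_zero]

/-- Conjugation by `g` only permutes the tableaux. -/
theorem single_mul_blockElement (lam : n.Partition) (g : Equiv.Perm (Fin n)) :
    single g 1 * blockElement lam = blockElement lam * single g 1 := by
  rw [blockElement, Finset.mul_sum, Finset.sum_mul]
  refine Fintype.sum_equiv (Equiv.equivCongr g (Equiv.refl _)) _ _ fun T => ?_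
  have : Equiv.equivCongr g (Equiv.refl _) T = g⁻¹.trans T := rfl
  rw [this, ← mul_assoc, ← mul_assoc, single_mul_rowSum, mul_assoc (rowSum _), single_mul_colSum,
    mul_assoc, mul_assoc (colSum _), single_mul_rowSum, mul_assoc, mul_assoc]

theorem coeff_blockElement_of_isConj (lam : n.Partition) {g h : Equiv.Perm (Fin n)}
    (hc : IsConj g h) : (blockElement lam).coeff g = (blockElement lam).coeff h := by
  obtain ⟨c, rfl⟩ := isConj_iff.1 hc
  have := congrArg (fun y : 𝔸 => y.coeff (c * g)) (single_mul_blockElement lam c)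
  simpa using this

/-- The row group and the column group of a tableau meet only in the identity, so `R_T C_T R_T` has
a positive coefficient at the identity. -/
theorem coeff_blockElement_one_pos (lam : n.Partition) : 0 < (blockElement lam).coeff 1 := by
  classical
  have key : ∀ T : Tableau lam, 0 < (rowSum T * colSum T * rowSum T).coeff 1 := by
    intro T
    -- `p q p' = 1` puts `q` into the row group, and only the identity is in both groups.
    have hone : ∀ p q p' : Equiv.Perm (Fin n), (∀ i, (T (p i)).1.1 = (T i).1.1) →
        (∀ i, (T (q i)).1.2 = (T i).1.2) → (∀ i, (T (p' i)).1.1 = (T i).1.1) →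
        p * q * p' = 1 → q = 1 := by
      intro p q p' hp hq hp' h
      ext1 i
      refine T.injective (Subtype.ext (Prod.ext ?_ (hq i)))
      have h1 : p (q i) = p'⁻¹ i := by
        have := congrArg (fun e : Equiv.Perm (Fin n) => e (p'⁻¹ i)) h
        simpa using this
      have h2 := hp' (p'⁻¹ i)
      rw [← h1, hp, h1] at h2
      simpa using h2.symm
    have hexp : (rowSum T * colSum T * rowSum T).coeff 1 =
        ∑ p : Equiv.Perm (Fin n) with ∀ i, (T (p i)).1.1 = (T i).1.1,
          ∑ q : Equiv.Perm (Fin n) with ∀ i, (T (q i)).1.2 = (T i).1.2,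
            ∑ p' : Equiv.Perm (Fin n) with ∀ i, (T (p' i)).1.1 = (T i).1.1,
              if p * q * p' = 1 then (1 : ℝ) else 0 := by
      rw [rowSum, colSum, Finset.sum_mul_sum, Finset.sum_mul, MonoidAlgebra.coeff_sum,
        Finsupp.finsetSum_apply]
      refine Finset.sum_congr rfl fun p hp => ?_
      rw [Finset.sum_mul_sum, MonoidAlgebra.coeff_sum, Finsupp.finsetSum_apply]
      refine Finset.sum_congr rfl fun q hq => ?_
      rw [MonoidAlgebra.coeff_sum, Finsupp.finsetSum_apply]
      refine Finset.sum_congr rfl fun p' hp' => ?_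
      rw [MonoidAlgebra.single_mul_single, MonoidAlgebra.single_mul_single,
        MonoidAlgebra.coeff_single, Finsupp.single_apply]
      split_ifs with h
      · rw [hone p q p' (Finset.mem_filter.1 hp).2 (Finset.mem_filter.1 hq).2
          (Finset.mem_filter.1 hp').2 h]
        simp
      · rfl
    have hnn : ∀ p q p' : Equiv.Perm (Fin n), (0 : ℝ) ≤ if p * q * p' = 1 then 1 else 0 :=
      fun p q p' => by split_ifs <;> norm_num
    rw [hexp]
    refine Finset.sum_pos' (fun p _ => Finset.sum_nonneg fun q _ => Finset.sum_nonneg fun p' _ =>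
      hnn p q p') ⟨1, by simp, ?_⟩
    refine Finset.sum_pos' (fun q _ => Finset.sum_nonneg fun p' _ => hnn 1 q p') ⟨1, by simp, ?_⟩
    exact Finset.sum_pos' (fun p' _ => hnn 1 1 p') ⟨1, by simp, by simp⟩
  rw [blockElement, MonoidAlgebra.coeff_sum, Finsupp.finsetSum_apply]
  exact Finset.sum_pos (fun T _ => key T) Finset.univ_nonempty

theorem coeff_mul_one (x y : 𝔸) : (x * y).coeff 1 = ∑ g, x.coeff g * y.coeff g⁻¹ := by
  classical
  rw [MonoidAlgebra.coeff_mul, Finsupp.sum_fintype _ _ (by simp)]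
  refine Finset.sum_congr rfl fun g _ => ?_
  rw [Finsupp.sum_fintype _ _ (by simp), Finset.sum_eq_single g⁻¹]
  · simp
  · intro h _ hh
    rw [if_neg fun h' => hh (eq_inv_of_mul_eq_one_right h')]
  · simp

theorem blockElement_mul_self_ne_zero (lam : n.Partition) :
    blockElement lam * blockElement lam ≠ 0 := by
  intro h
  have h1 := coeff_mul_one (blockElement lam) (blockElement lam)
  rw [h, MonoidAlgebra.coeff_zero, Finsupp.zero_apply] at h1
  -- A permutation is conjugate to its inverse, so the coefficient of the square at the identity is
  -- a sum of squares.
  have h2 : ∀ g, (blockElement lam).coeff g⁻¹ = (blockElement lam).coeff g := fun g =>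
    coeff_blockElement_of_isConj lam (by
      rw [Equiv.Perm.isConj_iff_cycleType_eq, Equiv.Perm.cycleType_inv])
  simp only [h2] at h1
  have h3 := (Finset.sum_eq_zero_iff_of_nonneg fun g _ => mul_self_nonneg _).1 h1.symm 1
    (Finset.mem_univ _)
  exact (mul_self_pos.2 (coeff_blockElement_one_pos lam).ne').ne' h3

theorem linearIndependent_blockElement :
    LinearIndependent ℝ (blockElement : n.Partition → 𝔸) := by
  classical
  rw [Fintype.linearIndependent_iff]
  intro a ha mu
  have h := congrArg (· * blockElement mu) ha
  simp only [Finset.sum_mul, zero_mul, smul_mul_assoc] at h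
  rw [Finset.sum_eq_single mu (fun lam _ hl => by rw [blockElement_mul_blockElement hl, smul_zero])
    (by simp)] at h
  by_contra hmu
  apply blockElement_mul_self_ne_zero mu
  have := congrArg (fun y => (a mu)⁻¹ • y) h
  simpa [smul_smul, inv_mul_cancel₀ hmu] using this

/-- The linear map sending a function of cycle types to the corresponding class function. -/
noncomputable def classFunction (n : ℕ) :
    ((Fintype.card (Fin n)).Partition → ℝ) →ₗ[ℝ] MonoidAlgebra ℝ (Equiv.Perm (Fin n)) where
  toFun f := ∑ g, single g (f g.partition)
  map_add' f f' := by simp [MonoidAlgebra.single_add, Finset.sum_add_distrib]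
  map_smul' r f := by simp [Finset.smul_sum]

theorem mem_range_classFunction {x : 𝔸} (hx : ∀ g h, IsConj g h → x.coeff g = x.coeff h) :
    x ∈ LinearMap.range (classFunction n) := by
  classical
  have hfac : Function.FactorsThrough (fun g => x.coeff g)
      (Equiv.Perm.partition : Equiv.Perm (Fin n) → _) :=
    fun g h hgh => hx g h (Equiv.Perm.partition_eq_of_isConj.2 hgh)
  refine ⟨Function.extend Equiv.Perm.partition (fun g => x.coeff g) 0, ?_⟩
  ext g
  simp only [classFunction, LinearMap.coe_mk, AddHom.coe_mk, MonoidAlgebra.coeff_sum,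
    Finsupp.finsetSum_apply, MonoidAlgebra.coeff_single, hfac.extend_apply]
  simp [Finsupp.single_apply]

/-- There are as many partitions of `n` as conjugacy classes of permutations, so the independent
elements `blockElement lam` span all class functions, and the identity is one. -/
theorem one_mem_span_blockElement :
    (1 : 𝔸) ∈ Submodule.span ℝ (Set.range (blockElement : n.Partition → 𝔸)) := by
  classical
  have hle : Submodule.span ℝ (Set.range (blockElement : n.Partition → 𝔸)) ≤
      LinearMap.range (classFunction n) := by
    rw [Submodule.span_le]
    rintro _ ⟨lam, rfl⟩
    exact mem_range_classFunction fun g h => coeff_blockElement_of_isConj lam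
  have heq := Submodule.eq_of_le_of_finrank_le hle (by
    rw [finrank_span_eq_card linearIndependent_blockElement]
    refine (LinearMap.finrank_range_le _).trans ?_
    rw [Module.finrank_fintype_fun_eq_card, Fintype.card_fin])
  rw [heq]
  refine mem_range_classFunction fun g h hgh => ?_
  have : 1 = g ↔ 1 = h := by
    obtain ⟨c, rfl⟩ := isConj_iff.1 hgh
    constructor
    · rintro rfl; simp
    · intro h1
      rw [eq_comm, mul_inv_eq_one] at h1
      simpa [eq_comm] using h1
  simp [MonoidAlgebra.one_def, Finsupp.single_apply, this]

end GroupAlgebra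

/-! ### Schur–Weyl projectors -/

omit [Fintype d] in
theorem permUnitary_one (n : ℕ) : permUnitary d (1 : Equiv.Perm (Fin n)) = 1 := by
  ext a b
  simp [permUnitary, Matrix.one_apply, Equiv.Perm.one_def]

theorem permUnitary_mul {n : ℕ} (π ρ : Equiv.Perm (Fin n)) :
    permUnitary d (π * ρ) = permUnitary d π * permUnitary d ρ := by
  ext a b
  simp only [permUnitary, Matrix.mul_apply, Matrix.of_apply, Function.comp_assoc,
    Equiv.Perm.mul_def, mul_ite, mul_one, mul_zero,
    Finset.sum_ite_eq', Finset.mem_univ, if_true]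
  congr

omit [Fintype d] in
theorem conjTranspose_permUnitary {n : ℕ} (π : Equiv.Perm (Fin n)) :
    (permUnitary d π)ᴴ = permUnitary d π⁻¹ := by
  ext a b
  have : b = a ∘ π.symm ↔ a = b ∘ π := by
    rw [Equiv.eq_comp_symm, eq_comm]
  simp [permUnitary, this, apply_ite, Equiv.Perm.inv_def]

theorem isPermutationInvariant_iff {n : ℕ} {B : Matrix (Fin n → d) (Fin n → d) ℂ} :
    IsPermutationInvariant B ↔ ∀ π, Commute (permUnitary d π) B := by
  refine forall_congr' fun π => ?_
  have h1 : (permUnitary d π)ᴴ * permUnitary d π = 1 := by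
    rw [conjTranspose_permUnitary, ← permUnitary_mul, inv_mul_cancel, permUnitary_one]
  have h2 : permUnitary d π * (permUnitary d π)ᴴ = 1 := by
    rw [conjTranspose_permUnitary, ← permUnitary_mul, mul_inv_cancel, permUnitary_one]
  constructor
  · intro h
    calc permUnitary d π * B = permUnitary d π * B * ((permUnitary d π)ᴴ * permUnitary d π) := by
          rw [h1, mul_one]
      _ = B * permUnitary d π := by rw [← mul_assoc, h]
  · intro h
    rw [h.eq, mul_assoc, h2, mul_one]

/-- The representation of the group algebra of the symmetric group on `X^n`. -/
noncomputable def permRep (d : Type*) [Fintype d] [DecidableEq d] (n : ℕ) :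
    MonoidAlgebra ℝ (Equiv.Perm (Fin n)) →ₐ[ℝ] Matrix (Fin n → d) (Fin n → d) ℂ :=
  MonoidAlgebra.lift ℝ _ (Equiv.Perm (Fin n))
    { toFun := permUnitary d
      map_one' := permUnitary_one n
      map_mul' := permUnitary_mul }

theorem permRep_single {n : ℕ} (π : Equiv.Perm (Fin n)) (r : ℝ) :
    permRep d n (MonoidAlgebra.single π r) = r • permUnitary d π := by
  simp [permRep, MonoidAlgebra.lift_single]

theorem permRep_rowSum {n : ℕ} {lam : n.Partition} (T : Tableau lam) :
    permRep d n (rowSum T) = rowSymmetrizer d T := by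
  simp [rowSum, rowSymmetrizer, permRep_single]

theorem permRep_colSum {n : ℕ} {lam : n.Partition} (T : Tableau lam) :
    permRep d n (colSum T) = columnAntisymmetrizer d T := by
  simp only [colSum, columnAntisymmetrizer, map_sum, permRep_single]
  refine Finset.sum_congr rfl fun π _ => ?_
  ext a b
  simp

omit [Fintype d] in
theorem conjTranspose_rowSymmetrizer {n : ℕ} {lam : n.Partition} (T : Tableau lam) :
    (rowSymmetrizer d T)ᴴ = rowSymmetrizer d T := by
  rw [rowSymmetrizer, Matrix.conjTranspose_sum]
  refine Finset.sum_equiv (Equiv.inv _) (fun π => ?_) fun π _ => conjTranspose_permUnitary π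
  simp only [Finset.mem_filter, Finset.mem_univ, true_and, Equiv.inv_apply]
  exact ⟨fun h i => by simpa using (h (π⁻¹ i)).symm, fun h i => by simpa using (h (π i)).symm⟩

omit [Fintype d] in
theorem conjTranspose_columnAntisymmetrizer {n : ℕ} {lam : n.Partition} (T : Tableau lam) :
    (columnAntisymmetrizer d T)ᴴ = columnAntisymmetrizer d T := by
  rw [columnAntisymmetrizer, Matrix.conjTranspose_sum]
  refine Finset.sum_equiv (Equiv.inv _) (fun π => ?_) fun π _ => ?_
  · simp only [Finset.mem_filter, Finset.mem_univ, true_and, Equiv.inv_apply]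
    exact ⟨fun h i => by simpa using (h (π⁻¹ i)).symm, fun h i => by simpa using (h (π i)).symm⟩
  · simp [Matrix.conjTranspose_smul, conjTranspose_permUnitary]

/-- With `R`, `C` and `R'`, `C'` for the symmetrizers of two tableaux, `(R C)ᴴ R' C' = C R R' C'`,
which vanishes because `R x C' = 0` or `C x R' = 0` for all `x`. -/
theorem schurWeylBlock_isOrtho {n : ℕ} {lam mu : n.Partition} (h : lam ≠ mu) :
    schurWeylBlock d lam ⟂ schurWeylBlock d mu := by
  rw [schurWeylBlock, schurWeylBlock, Submodule.isOrtho_iSup_left]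
  intro T
  rw [Submodule.isOrtho_iSup_right]
  intro T'
  apply range_toEuclideanLin_isOrtho
  rw [youngSymmetrizer, youngSymmetrizer, Matrix.conjTranspose_mul, conjTranspose_rowSymmetrizer,
    conjTranspose_columnAntisymmetrizer, ← permRep_rowSum, ← permRep_rowSum, ← permRep_colSum,
    ← permRep_colSum, ← map_mul, ← map_mul, ← map_mul]
  rcases not_dominated_or_not_dominated h with h | h
  · rw [← mul_assoc, mul_assoc (colSum T), mul_assoc (colSum T), rowSum_mul_mul_colSum h, mul_zero,
      map_zero]
  · rw [← mul_assoc, colSum_mul_mul_rowSum h, zero_mul, map_zero]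

theorem toEuclideanLin_mul_apply {ι : Type*} [Fintype ι] [DecidableEq ι] (A B : Matrix ι ι ℂ)
    (v : EuclideanSpace ℂ ι) : Matrix.toEuclideanLin (A * B) v =
      Matrix.toEuclideanLin A (Matrix.toEuclideanLin B v) := by
  ext1
  simp [Matrix.toLpLin_apply]

theorem toEuclideanLin_permRep_blockElement_mem {n : ℕ} (lam : n.Partition)
    (v : EuclideanSpace ℂ (Fin n → d)) :
    Matrix.toEuclideanLin (permRep d n (blockElement lam)) v ∈ schurWeylBlock d lam := by
  rw [blockElement, map_sum, map_sum, LinearMap.sum_apply]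
  refine Submodule.sum_mem _ fun T _ => Submodule.mem_iSup_of_mem T ?_
  have hT : permRep d n (rowSum T * colSum T * rowSum T) =
      youngSymmetrizer d T * rowSymmetrizer d T := by
    rw [map_mul, map_mul, permRep_rowSum, permRep_colSum, youngSymmetrizer]
  rw [hT, toEuclideanLin_mul_apply]
  exact LinearMap.mem_range_self _ _

/-- Completeness of the Schur–Weyl blocks: the identity of the group algebra is a combination of the
elements `blockElement lam`, each of which maps `X^n` into the block of `lam`. -/
theorem iSup_schurWeylBlock (n : ℕ) : ⨆ lam : n.Partition, schurWeylBlock d lam = ⊤ := by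
  rw [eq_top_iff]
  intro v _
  obtain ⟨c, hc⟩ := (Submodule.mem_span_range_iff_exists_fun ℝ).1
    (one_mem_span_blockElement (n := n))
  have h := congrArg (fun x => Matrix.toEuclideanLin (permRep d n x) v) hc
  simp only [map_one, map_sum, map_smul, LinearMap.sum_apply] at h
  have h1 : Matrix.toEuclideanLin (1 : Matrix (Fin n → d) (Fin n → d) ℂ) v = v := by
    ext1
    simp
  rw [h1] at h
  rw [← h]
  refine Submodule.sum_mem _ fun lam _ => Submodule.mem_iSup_of_mem lam ?_
  have h2 : Matrix.toEuclideanLin (c lam • permRep d n (blockElement lam)) v =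
      (c lam : ℂ) • Matrix.toEuclideanLin (permRep d n (blockElement lam)) v := by
    have h3 : c lam • permRep d n (blockElement lam) =
        (c lam : ℂ) • permRep d n (blockElement lam) := by
      ext a b
      simp
    rw [h3, map_smul, LinearMap.smul_apply]
  rw [h2]
  exact Submodule.smul_mem _ _ (toEuclideanLin_permRep_blockElement_mem lam v)

theorem schurWeylProjector_mul_self {n : ℕ} (lam : n.Partition) :
    schurWeylProjector d lam * schurWeylProjector d lam = schurWeylProjector d lam :=
  orthogonalProjector_mul_self _

theorem schurWeylProjector_mul_eq_zero {n : ℕ} {lam mu : n.Partition} (h : lam ≠ mu) :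
    schurWeylProjector d lam * schurWeylProjector d mu = 0 :=
  orthogonalProjector_mul_eq_zero (schurWeylBlock_isOrtho h)

theorem sum_schurWeylProjector (n : ℕ) :
    ∑ lam : n.Partition, schurWeylProjector d lam = 1 :=
  sum_orthogonalProjector_eq_one (fun _ _ h => schurWeylBlock_isOrtho h) (iSup_schurWeylBlock n)

theorem commute_permRep {n : ℕ} (x : MonoidAlgebra ℝ (Equiv.Perm (Fin n)))
    {B : Matrix (Fin n → d) (Fin n → d) ℂ} (h : ∀ π, Commute (permUnitary d π) B) :
    Commute (permRep d n x) B := by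
  induction x using MonoidAlgebra.induction_linear with
  | zero => simp
  | add x y hx hy => rw [map_add]; exact hx.add_left hy
  | single g r => rw [permRep_single]; exact (h g).smul_left r

theorem mem_schurWeylBlock_of_commute {n : ℕ} {lam : n.Partition}
    {B : Matrix (Fin n → d) (Fin n → d) ℂ} (h : ∀ π, Commute (permUnitary d π) B)
    {v : EuclideanSpace ℂ (Fin n → d)} (hv : v ∈ schurWeylBlock d lam) :
    Matrix.toEuclideanLin B v ∈ schurWeylBlock d lam := by
  suffices schurWeylBlock d lam ≤ (schurWeylBlock d lam).comap (Matrix.toEuclideanLin B) from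
    this hv
  refine iSup_le fun T => ?_
  rintro _ ⟨w, rfl⟩
  rw [Submodule.mem_comap]
  refine Submodule.mem_iSup_of_mem T ?_
  have hc : Commute (youngSymmetrizer d T) B := by
    rw [youngSymmetrizer, ← permRep_rowSum, ← permRep_colSum, ← map_mul]
    exact commute_permRep _ h
  rw [← toEuclideanLin_mul_apply, ← hc.eq, toEuclideanLin_mul_apply]
  exact LinearMap.mem_range_self _ _

theorem commute_schurWeylProjector {n : ℕ} (lam : n.Partition)
    {B : Matrix (Fin n → d) (Fin n → d) ℂ} (h : ∀ π, Commute (permUnitary d π) B) :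
    Commute (schurWeylProjector d lam) B := by
  refine commute_orthogonalProjector (fun v hv => mem_schurWeylBlock_of_commute h hv)
    fun v hv => mem_schurWeylBlock_of_commute (fun π => ?_) hv
  have := congrArg Matrix.conjTranspose (h π⁻¹).eq
  rw [Matrix.conjTranspose_mul, Matrix.conjTranspose_mul, conjTranspose_permUnitary,
    inv_inv] at this
  exact this.symm

/-- The permutations do not commute with each other, but they only permute the tableaux of a
shape. -/
theorem commute_schurWeylProjector_permUnitary {n : ℕ} (lam : n.Partition)
    (π : Equiv.Perm (Fin n)) : Commute (schurWeylProjector d lam) (permUnitary d π) := by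
  have key : ∀ ρ : Equiv.Perm (Fin n), ∀ v ∈ schurWeylBlock d lam,
      Matrix.toEuclideanLin (permUnitary d ρ) v ∈ schurWeylBlock d lam := by
    intro ρ v hv
    suffices schurWeylBlock d lam ≤
        (schurWeylBlock d lam).comap (Matrix.toEuclideanLin (permUnitary d ρ)) from this hv
    refine iSup_le fun T => ?_
    rintro _ ⟨w, rfl⟩
    rw [Submodule.mem_comap]
    refine Submodule.mem_iSup_of_mem (ρ⁻¹.trans T) ?_
    have hc : permUnitary d ρ * youngSymmetrizer d T =
        youngSymmetrizer d (ρ⁻¹.trans T : Tableau lam) * permUnitary d ρ := by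
      rw [youngSymmetrizer, youngSymmetrizer, ← permRep_rowSum, ← permRep_colSum, ← permRep_rowSum,
        ← permRep_colSum, ← one_smul ℝ (permUnitary d ρ), ← permRep_single, ← map_mul, ← map_mul,
        ← map_mul, ← map_mul, ← mul_assoc, single_mul_rowSum, mul_assoc, single_mul_colSum,
        mul_assoc]
    rw [← toEuclideanLin_mul_apply, hc, toEuclideanLin_mul_apply]
    exact LinearMap.mem_range_self _ _
  refine commute_orthogonalProjector (key π) ?_
  rw [conjTranspose_permUnitary]
  exact key π⁻¹

/-! ### Infinitesimal time covariance -/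

section TimeCovariance

section NormedAlgebra

variable {A : Type*} [NormedRing A] [NormedAlgebra ℂ A] [CompleteSpace A]

/-- The derivative at time zero of the evolution `e^{-iHt} M e^{iHt}` is `-i [H, M]`. -/
theorem hasDerivAt_exp_conj (H M : A) :
    HasDerivAt (fun t : ℝ => NormedSpace.exp ((-(Complex.I * (t : ℂ))) • H) * M *
      NormedSpace.exp ((Complex.I * (t : ℂ)) • H)) (-Complex.I • (H * M - M * H)) 0 := by
  have key : ∀ z : ℂ, HasDerivAt (fun t : ℝ => NormedSpace.exp ((z * (t : ℂ)) • H)) (z • H) 0 := by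
    intro z
    have h := hasDerivAt_exp_smul_const (𝕂 := ℝ) (z • H) (0 : ℝ)
    simp only [zero_smul, NormedSpace.exp_zero, one_mul] at h
    have e : ∀ t : ℝ, (z * (t : ℂ)) • H = t • z • H := fun t => by
      rw [mul_comm, mul_smul, Complex.coe_smul]
    simpa only [e] using h
  have h3 := ((key (-Complex.I)).mul_const M).mul (key Complex.I)
  simp only [Complex.ofReal_zero, mul_zero, zero_smul, NormedSpace.exp_zero, one_mul,
    mul_one] at h3
  convert h3 using 1
  · ext t
    simp
  · simp [sub_eq_neg_add, add_comm]

theorem commute_of_exp_conj_eq {H M : A}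
    (h : ∀ t : ℝ, NormedSpace.exp ((-(Complex.I * (t : ℂ))) • H) * M *
      NormedSpace.exp ((Complex.I * (t : ℂ)) • H) = M) : Commute H M := by
  have h1 := hasDerivAt_exp_conj H M
  simp only [h] at h1
  have h2 := h1.unique (hasDerivAt_const _ _)
  rw [smul_eq_zero, sub_eq_zero] at h2
  exact h2.resolve_left (by simp)

theorem map_commutator_of_map_exp_conj {H : A} (F : A →L[ℂ] A)
    (h : ∀ (t : ℝ) (M : A), F (NormedSpace.exp ((-(Complex.I * (t : ℂ))) • H) * M *
      NormedSpace.exp ((Complex.I * (t : ℂ)) • H)) =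
        NormedSpace.exp ((-(Complex.I * (t : ℂ))) • H) * F M *
          NormedSpace.exp ((Complex.I * (t : ℂ)) • H)) (M : A) :
    F (H * M - M * H) = H * F M - F M * H := by
  have h1 := (F.restrictScalars ℝ).hasFDerivAt.comp_hasDerivAt (0 : ℝ) (hasDerivAt_exp_conj H M)
  have h2 := hasDerivAt_exp_conj H (F M)
  simp only [← h] at h2
  have h3 : F (-Complex.I • (H * M - M * H)) = _ := h1.unique h2
  rw [map_smul] at h3
  exact smul_right_injective _ (by simp) h3

end NormedAlgebra

variable {ι : Type*} [Fintype ι] [DecidableEq ι]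

open scoped Matrix.Norms.Operator in
/-- A state invariant under the time evolution commutes with the Hamiltonian. -/
theorem IsTimeCovariantState.commute {H ρ : Matrix ι ι ℂ} (h : IsTimeCovariantState H ρ) :
    Commute H ρ :=
  commute_of_exp_conj_eq h

open scoped Matrix.Norms.Operator in
/-- The derivative at time zero of the covariance condition. -/
theorem IsTimeCovariantChannel.map_commutator {H : Matrix ι ι ℂ}
    {F : Matrix ι ι ℂ →ₗ[ℂ] Matrix ι ι ℂ} (h : IsTimeCovariantChannel H F) (M : Matrix ι ι ℂ) :
    F (H * M - M * H) = H * F M - F M * H :=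
  map_commutator_of_map_exp_conj F.toContinuousLinearMap h M

end TimeCovariance

/-! ### Tensor powers of a map -/

/-- The product operator `M_1 ⊗ ⋯ ⊗ M_n`. -/
noncomputable def productMatrix {n : ℕ} (M : Fin n → Matrix d d ℂ) :
    Matrix (Fin n → d) (Fin n → d) ℂ :=
  Matrix.of fun a b => ∏ i, M i (a i) (b i)

omit [Fintype d] in
theorem single_eq_productMatrix {n : ℕ} (a b : Fin n → d) :
    (Matrix.single a b 1 : Matrix (Fin n → d) (Fin n → d) ℂ) =
      productMatrix fun i => Matrix.single (a i) (b i) 1 := by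
  ext x y
  simp only [productMatrix, Matrix.of_apply, Matrix.single_apply, Finset.prod_ite_zero,
    Finset.prod_const_one, funext_iff, Finset.mem_univ, forall_const, forall_and]

theorem tensorPower_productMatrix {n : ℕ} (F : Matrix d d ℂ →ₗ[ℂ] Matrix d d ℂ)
    (M : Fin n → Matrix d d ℂ) :
    tensorPower n F (productMatrix M) = productMatrix fun i => F (M i) := by
  ext a b
  have key : ∀ i, F (M i) (a i) (b i) =
      ∑ p : d × d, M i p.1 p.2 * F (Matrix.single p.1 p.2 1) (a i) (b i) := by
    intro i
    conv_lhs => rw [Matrix.matrix_eq_sum_single (M i)]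
    rw [Fintype.sum_prod_type]
    simp only [map_sum, Matrix.sum_apply]
    refine Finset.sum_congr rfl fun x _ => Finset.sum_congr rfl fun y _ => ?_
    have h : (Matrix.single x y (M i x y) : Matrix d d ℂ) = M i x y • Matrix.single x y 1 := by simp
    rw [h, map_smul, Matrix.smul_apply, smul_eq_mul]
  simp only [productMatrix, Matrix.of_apply, key, tensorPower, LinearMap.coe_mk, AddHom.coe_mk,
    ← Finset.prod_mul_distrib]
  rw [Finset.prod_univ_sum, Fintype.piFinset_univ, ← Fintype.sum_prod_type',
    ← (Equiv.arrowProdEquivProdArrow (Fin n) (fun _ => d) (fun _ => d)).sum_comp]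
  rfl

/-- Linear maps on `X^n` agree if they agree on product operators. -/
theorem linearMap_ext_productMatrix {n : ℕ} {V : Type*} [AddCommGroup V] [Module ℂ V]
    {f g : Matrix (Fin n → d) (Fin n → d) ℂ →ₗ[ℂ] V}
    (h : ∀ M : Fin n → Matrix d d ℂ, f (productMatrix M) = g (productMatrix M)) : f = g := by
  refine Matrix.ext_linearMap _ fun a b => LinearMap.ext fun z => ?_
  have hz : (Matrix.single a b z : Matrix (Fin n → d) (Fin n → d) ℂ) =
      z • Matrix.single a b 1 := by simp
  simp only [LinearMap.comp_apply, Matrix.singleLinearMap_apply]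
  rw [hz, map_smul, map_smul, single_eq_productMatrix, h]

omit [DecidableEq d] in
theorem productMatrix_mul_productMatrix {n : ℕ} (M N : Fin n → Matrix d d ℂ) :
    productMatrix M * productMatrix N = productMatrix fun i => M i * N i := by
  ext a b
  simp only [productMatrix, Matrix.mul_apply, Matrix.of_apply, ← Finset.prod_mul_distrib]
  rw [Finset.prod_univ_sum, Fintype.piFinset_univ]

omit [Fintype d] [DecidableEq d] in
theorem productMatrix_update_apply {n : ℕ} (M : Fin n → Matrix d d ℂ) (i : Fin n)
    (A : Matrix d d ℂ) (a b : Fin n → d) : productMatrix (Function.update M i A) a b =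
      A (a i) (b i) * ∏ j ∈ Finset.univ.erase i, M j (a j) (b j) := by
  rw [productMatrix, Matrix.of_apply, ← Finset.mul_prod_erase _ _ (Finset.mem_univ i),
    Function.update_self]
  congr 1
  refine Finset.prod_congr rfl fun j hj => ?_
  rw [Function.update_of_ne (Finset.ne_of_mem_erase hj)]

omit [Fintype d] [DecidableEq d] in
theorem productMatrix_update_sub {n : ℕ} (M : Fin n → Matrix d d ℂ) (i : Fin n)
    (A B : Matrix d d ℂ) : productMatrix (Function.update M i (A - B)) =
      productMatrix (Function.update M i A) - productMatrix (Function.update M i B) := by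
  ext a b
  simp only [Matrix.sub_apply, productMatrix_update_apply, sub_mul]

omit [Fintype d] in
theorem totalHamiltonian_eq_sum_productMatrix (n : ℕ) (H : Matrix d d ℂ) :
    totalHamiltonian n H = ∑ i, productMatrix (Function.update (fun _ => 1) i H) := by
  refine Finset.sum_congr rfl fun i _ => ?_
  ext a b
  rw [productMatrix_update_apply]
  simp only [Matrix.of_apply, Matrix.one_apply, Finset.prod_ite_zero, Finset.prod_const_one,
    Finset.mem_erase, Finset.mem_univ, and_true, mul_ite, mul_one, mul_zero]

theorem totalHamiltonian_mul_productMatrix {n : ℕ} (H : Matrix d d ℂ) (M : Fin n → Matrix d d ℂ) :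
    totalHamiltonian n H * productMatrix M =
      ∑ i, productMatrix (Function.update M i (H * M i)) := by
  rw [totalHamiltonian_eq_sum_productMatrix, Finset.sum_mul]
  refine Finset.sum_congr rfl fun i _ => ?_
  rw [productMatrix_mul_productMatrix]
  congr 1
  ext1 j
  rcases eq_or_ne j i with rfl | hj
  · simp
  · simp [Function.update_of_ne hj]

theorem productMatrix_mul_totalHamiltonian {n : ℕ} (H : Matrix d d ℂ) (M : Fin n → Matrix d d ℂ) :
    productMatrix M * totalHamiltonian n H =
      ∑ i, productMatrix (Function.update M i (M i * H)) := by
  rw [totalHamiltonian_eq_sum_productMatrix, Finset.mul_sum]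
  refine Finset.sum_congr rfl fun i _ => ?_
  rw [productMatrix_mul_productMatrix]
  congr 1
  ext1 j
  rcases eq_or_ne j i with rfl | hj
  · simp
  · simp [Function.update_of_ne hj]

/-- `F^{⊗ n}` commutes with the commutator with the total Hamiltonian, by the Leibniz rule on
product operators. -/
theorem tensorPower_commutator {n : ℕ} {H : Matrix d d ℂ} {F : Matrix d d ℂ →ₗ[ℂ] Matrix d d ℂ}
    (h : ∀ M, F (H * M - M * H) = H * F M - F M * H) (M : Matrix (Fin n → d) (Fin n → d) ℂ) :
    tensorPower n F (totalHamiltonian n H * M - M * totalHamiltonian n H) =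
      totalHamiltonian n H * tensorPower n F M - tensorPower n F M * totalHamiltonian n H := by
  set K := totalHamiltonian n H with hK
  let ad : Matrix (Fin n → d) (Fin n → d) ℂ →ₗ[ℂ] Matrix (Fin n → d) (Fin n → d) ℂ :=
    LinearMap.mulLeft ℂ K - LinearMap.mulRight ℂ K
  suffices (tensorPower n F).comp ad = ad.comp (tensorPower n F) from LinearMap.congr_fun this M
  refine linearMap_ext_productMatrix fun M => ?_
  simp only [LinearMap.comp_apply, ad, LinearMap.sub_apply, LinearMap.mulLeft_apply,
    LinearMap.mulRight_apply, tensorPower_productMatrix, hK, totalHamiltonian_mul_productMatrix,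
    productMatrix_mul_totalHamiltonian, ← Finset.sum_sub_distrib, map_sum,
    ← productMatrix_update_sub]
  refine Finset.sum_congr rfl fun i _ => ?_
  rw [← h]
  congr 1
  ext1 j
  rcases eq_or_ne j i with rfl | hj
  · simp
  · simp [Function.update_of_ne hj]

theorem commute_totalHamiltonian_tensorPower {n : ℕ} {H : Matrix d d ℂ}
    {F : Matrix d d ℂ →ₗ[ℂ] Matrix d d ℂ} (hF : IsTimeCovariantChannel H F)
    {M : Matrix (Fin n → d) (Fin n → d) ℂ} (h : Commute (totalHamiltonian n H) M) :
    Commute (totalHamiltonian n H) (tensorPower n F M) := by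
  have := tensorPower_commutator hF.map_commutator M
  rw [h.eq, sub_self, map_zero] at this
  exact (sub_eq_zero.1 this.symm)

theorem permUnitary_mul_apply {n : ℕ} (π : Equiv.Perm (Fin n))
    (M : Matrix (Fin n → d) (Fin n → d) ℂ) (a b : Fin n → d) :
    (permUnitary d π * M) a b = M (a ∘ π) b := by
  have : ∀ c : Fin n → d, a = c ∘ π.symm ↔ c = a ∘ π := fun c => by
    rw [Equiv.eq_comp_symm, eq_comm]
  simp [permUnitary, Matrix.mul_apply, this]

theorem mul_permUnitary_apply {n : ℕ} (π : Equiv.Perm (Fin n))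
    (M : Matrix (Fin n → d) (Fin n → d) ℂ) (a b : Fin n → d) :
    (M * permUnitary d π) a b = M a (b ∘ π.symm) := by
  simp [permUnitary, Matrix.mul_apply]

theorem commute_permUnitary_tensorPower {n : ℕ} (F : Matrix d d ℂ →ₗ[ℂ] Matrix d d ℂ)
    {M : Matrix (Fin n → d) (Fin n → d) ℂ} (π : Equiv.Perm (Fin n))
    (h : Commute (permUnitary d π) M) : Commute (permUnitary d π) (tensorPower n F M) := by
  ext a b
  rw [permUnitary_mul_apply, mul_permUnitary_apply]
  have hM : ∀ c e, M (c ∘ π) (e ∘ π) = M c e := by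
    intro c e
    have := congrFun (congrFun h.eq c) (e ∘ π)
    rw [permUnitary_mul_apply, mul_permUnitary_apply] at this
    rw [this, Function.comp_assoc, Equiv.self_comp_symm, Function.comp_id]
  simp only [tensorPower, LinearMap.coe_mk, AddHom.coe_mk, Matrix.of_apply]
  let e : (Fin n → d) ≃ (Fin n → d) := Equiv.arrowCongr π (Equiv.refl d)
  refine Fintype.sum_equiv e _ _ fun c => Fintype.sum_equiv e _ _ fun c' => ?_
  have he : ∀ c, e c = c ∘ π.symm := fun c => rfl
  rw [he, he, ← hM (c ∘ π.symm)]
  simp only [Function.comp_assoc, Equiv.symm_comp_self, Function.comp_id]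
  congr 1
  refine Fintype.prod_equiv π _ _ fun i => ?_
  simp

theorem commute_totalHamiltonian_permUnitary {n : ℕ} (H : Matrix d d ℂ) (π : Equiv.Perm (Fin n)) :
    Commute (totalHamiltonian n H) (permUnitary d π) := by
  refine Commute.symm ?_
  ext a b
  rw [permUnitary_mul_apply, mul_permUnitary_apply, totalHamiltonian, Matrix.sum_apply,
    Matrix.sum_apply]
  refine Fintype.sum_equiv π _ _ fun i => ?_
  simp only [Matrix.of_apply, Function.comp_apply, Equiv.symm_apply_apply]
  congr 1
  rw [eq_iff_iff]
  refine ⟨fun h j hj => ?_, fun h j hj => ?_⟩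
  · simpa using h (π.symm j) (by rwa [Ne, Equiv.symm_apply_eq])
  · simpa using h (π j) (by simpa using hj)

/-! ### Joint energy and Schur–Weyl measurements -/

/-- Operators on `X^n` that commute with the total Hamiltonian and with all permutations of the
copies. -/
def IsSymmetricOperator {n : ℕ} (H : Matrix d d ℂ) (B : Matrix (Fin n → d) (Fin n → d) ℂ) : Prop :=
  Commute (totalHamiltonian n H) B ∧ ∀ π, Commute (permUnitary d π) B

theorem commute_energyProjector_schurWeylProjector {n : ℕ} {H : Matrix d d ℂ} (hH : H.IsHermitian)
    (E : ℝ) (lam : n.Partition) : Commute (energyProjector n H E) (schurWeylProjector d lam) :=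
  commute_energyProjector n hH
    (commute_schurWeylProjector lam fun π => (commute_totalHamiltonian_permUnitary H π).symm).symm E

theorem IsSymmetricOperator.commute_outcomeProjector {n : ℕ} {H : Matrix d d ℂ}
    (hH : H.IsHermitian) {B : Matrix (Fin n → d) (Fin n → d) ℂ} (hB : IsSymmetricOperator H B)
    (o : ℝ × n.Partition) : Commute (outcomeProjector n H o) B :=
  (commute_energyProjector n hH hB.1 o.1).mul_left (commute_schurWeylProjector o.2 hB.2)

theorem isSymmetricOperator_outcomeProjector {n : ℕ} {H : Matrix d d ℂ} (hH : H.IsHermitian)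
    (o : ℝ × n.Partition) : IsSymmetricOperator H (outcomeProjector n H o) := by
  refine ⟨?_, fun π => ?_⟩
  · exact (commute_energyProjector n hH (Commute.refl _) o.1).symm.mul_right
      (commute_schurWeylProjector o.2 fun π => (commute_totalHamiltonian_permUnitary H π).symm).symm
  · exact (commute_energyProjector n hH (commute_totalHamiltonian_permUnitary H π)
      o.1).symm.mul_right
      (commute_schurWeylProjector_permUnitary o.2 π).symm

theorem IsSymmetricOperator.mul {n : ℕ} {H : Matrix d d ℂ}
    {A B : Matrix (Fin n → d) (Fin n → d) ℂ} (hA : IsSymmetricOperator H A)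
    (hB : IsSymmetricOperator H B) : IsSymmetricOperator H (A * B) :=
  ⟨hA.1.mul_right hB.1, fun π => (hA.2 π).mul_right (hB.2 π)⟩

theorem IsSymmetricOperator.tensorPower {n : ℕ} {H : Matrix d d ℂ}
    {F : Matrix d d ℂ →ₗ[ℂ] Matrix d d ℂ} (hF : IsTimeCovariantChannel H F)
    {B : Matrix (Fin n → d) (Fin n → d) ℂ} (hB : IsSymmetricOperator H B) :
    IsSymmetricOperator H (WorkCostDephasing.tensorPower n F B) :=
  ⟨commute_totalHamiltonian_tensorPower hF hB.1,
    fun π => commute_permUnitary_tensorPower F π (hB.2 π)⟩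

theorem outcomeProjector_mul_outcomeProjector {n : ℕ} {H : Matrix d d ℂ} (hH : H.IsHermitian)
    [DecidableEq (ℝ × n.Partition)] (o o' : ℝ × n.Partition) :
    outcomeProjector n H o * outcomeProjector n H o' =
      if o = o' then outcomeProjector n H o else 0 := by
  have h : outcomeProjector n H o * outcomeProjector n H o' =
      (energyProjector n H o.1 * energyProjector n H o'.1) *
        (schurWeylProjector d o.2 * schurWeylProjector d o'.2) := by
    rw [outcomeProjector, outcomeProjector, mul_assoc, mul_assoc,
      ← mul_assoc (schurWeylProjector d _),
      ← (commute_energyProjector_schurWeylProjector hH o'.1 o.2).eq, mul_assoc]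
  rw [h]
  split_ifs with ho
  · rw [ho, energyProjector_mul_self, schurWeylProjector_mul_self, outcomeProjector]
  · rcases eq_or_ne o.1 o'.1 with h1 | h1
    · rw [schurWeylProjector_mul_eq_zero fun h2 => ho (Prod.ext h1 h2), mul_zero]
    · rw [energyProjector_mul_eq_zero n hH h1, zero_mul]

theorem sum_outcomeProjector (n : ℕ) {H : Matrix d d ℂ} (hH : H.IsHermitian) :
    ∑ o ∈ outcomes n H, outcomeProjector n H o = 1 := by
  simp only [outcomes, outcomeProjector, Finset.sum_product, ← Finset.mul_sum,
    sum_schurWeylProjector, mul_one, sum_energyProjector n hH]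

theorem IsSymmetricOperator.outcomeProjector_mul_mul {n : ℕ} {H : Matrix d d ℂ}
    (hH : H.IsHermitian) {B : Matrix (Fin n → d) (Fin n → d) ℂ} (hB : IsSymmetricOperator H B)
    [DecidableEq (ℝ × n.Partition)] (o o' : ℝ × n.Partition) :
    outcomeProjector n H o * B * outcomeProjector n H o' =
      if o = o' then outcomeProjector n H o * B else 0 := by
  rw [mul_assoc, ← (hB.commute_outcomeProjector hH o').eq, ← mul_assoc,
    outcomeProjector_mul_outcomeProjector hH, ite_mul, zero_mul]

/-! ### The dephased map on symmetric operators -/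

section Choi

variable {ι : Type*} [Fintype ι]

theorem mapOfChoi_sum {κ : Type*} (s : Finset κ) (C : κ → Matrix (ι × ι) (ι × ι) ℂ)
    (M : Matrix ι ι ℂ) : mapOfChoi (∑ x ∈ s, C x) M = ∑ x ∈ s, mapOfChoi (C x) M := by
  ext a b
  simp only [mapOfChoi, LinearMap.coe_mk, AddHom.coe_mk, Matrix.of_apply, Matrix.sum_apply,
    Finset.sum_mul]
  exact (Finset.sum_congr rfl fun r _ => Finset.sum_comm).trans Finset.sum_comm

variable [DecidableEq ι]

theorem mapOfChoi_kronecker_one_mul (A : Matrix ι ι ℂ) (C : Matrix (ι × ι) (ι × ι) ℂ)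
    (M : Matrix ι ι ℂ) : mapOfChoi ((A ⊗ₖ 1) * C) M = A * mapOfChoi C M := by
  ext a b
  simp only [mapOfChoi, LinearMap.coe_mk, AddHom.coe_mk, Matrix.of_apply, Matrix.mul_apply,
    Fintype.sum_prod_type, Matrix.kroneckerMap_apply, Matrix.one_apply, mul_ite, mul_one, mul_zero,
    ite_mul, zero_mul, Finset.sum_ite_eq, Finset.mem_univ, if_true, Finset.sum_mul, Finset.mul_sum,
    mul_assoc]
  exact (Finset.sum_congr rfl fun r _ => Finset.sum_comm).trans Finset.sum_comm

theorem mapOfChoi_mul_kronecker_one (A : Matrix ι ι ℂ) (C : Matrix (ι × ι) (ι × ι) ℂ)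
    (M : Matrix ι ι ℂ) : mapOfChoi (C * (A ⊗ₖ 1)) M = mapOfChoi C M * A := by
  ext a b
  simp only [mapOfChoi, LinearMap.coe_mk, AddHom.coe_mk, Matrix.of_apply, Matrix.mul_apply,
    Fintype.sum_prod_type, Matrix.kroneckerMap_apply, Matrix.one_apply, mul_ite, mul_one, mul_zero,
    Finset.sum_ite_eq', Finset.mem_univ, if_true, Finset.sum_mul]
  refine ((Finset.sum_congr rfl fun r _ => Finset.sum_comm).trans Finset.sum_comm).trans ?_
  simp only [mul_right_comm]

theorem mapOfChoi_one_kronecker_mul (B : Matrix ι ι ℂ) (C : Matrix (ι × ι) (ι × ι) ℂ)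
    (M : Matrix ι ι ℂ) : mapOfChoi ((1 ⊗ₖ Bᵀ) * C) M = mapOfChoi C (B * M) := by
  ext a b
  simp only [mapOfChoi, LinearMap.coe_mk, AddHom.coe_mk, Matrix.of_apply, Matrix.mul_apply,
    Fintype.sum_prod_type_right, Matrix.kroneckerMap_apply, Matrix.one_apply, ite_mul, one_mul,
    zero_mul, Finset.sum_ite_eq, Finset.mem_univ, if_true, Finset.sum_mul, Finset.mul_sum,
    Matrix.transpose_apply]
  refine ((Finset.sum_congr rfl fun r _ => Finset.sum_comm).trans Finset.sum_comm).trans ?_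
  refine Finset.sum_congr rfl fun r' _ => Finset.sum_comm.trans ?_
  exact Finset.sum_congr rfl fun s _ => Finset.sum_congr rfl fun r _ => by ring

theorem mapOfChoi_mul_one_kronecker (B : Matrix ι ι ℂ) (C : Matrix (ι × ι) (ι × ι) ℂ)
    (M : Matrix ι ι ℂ) : mapOfChoi (C * (1 ⊗ₖ Bᵀ)) M = mapOfChoi C (M * B) := by
  ext a b
  simp only [mapOfChoi, LinearMap.coe_mk, AddHom.coe_mk, Matrix.of_apply, Matrix.mul_apply,
    Fintype.sum_prod_type_right, Matrix.kroneckerMap_apply, Matrix.one_apply, ite_mul, one_mul,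
    mul_ite, mul_zero, zero_mul, Finset.sum_ite_eq', Finset.mem_univ, if_true, Finset.sum_mul,
    Finset.mul_sum, Matrix.transpose_apply]
  refine Finset.sum_congr rfl fun r _ => Finset.sum_comm.trans ?_
  exact Finset.sum_congr rfl fun s _ => Finset.sum_congr rfl fun s' _ => by ring

/-- Multiplying the Choi matrix of `G` by product operators on either side amounts to multiplying
the input and the output of `G`. -/
theorem mapOfChoi_kronecker_mul_mul_kronecker (A B A' B' : Matrix ι ι ℂ)
    (G : Matrix ι ι ℂ →ₗ[ℂ] Matrix ι ι ℂ) (M : Matrix ι ι ℂ) :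
    mapOfChoi ((A ⊗ₖ Bᵀ) * choiMatrix G * (A' ⊗ₖ B'ᵀ)) M = A * G (B * M * B') * A' := by
  have h : ∀ X Y : Matrix ι ι ℂ, X ⊗ₖ Yᵀ = (X ⊗ₖ 1) * (1 ⊗ₖ Yᵀ) := fun X Y => by
    rw [← Matrix.mul_kronecker_mul, mul_one, one_mul]
  rw [h A, h A', mul_assoc (A ⊗ₖ 1), mul_assoc (A ⊗ₖ 1), mapOfChoi_kronecker_one_mul,
    ← mul_assoc (_ * choiMatrix G), mapOfChoi_mul_one_kronecker, mapOfChoi_mul_kronecker_one,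
    mapOfChoi_one_kronecker_mul, mapOfChoi_choiMatrix, mul_assoc, mul_assoc]

end Choi

theorem workCostDephased_apply (n : ℕ) (β : ℝ) (H : Matrix d d ℂ)
    (F : Matrix d d ℂ →ₗ[ℂ] Matrix d d ℂ) (M : Matrix (Fin n → d) (Fin n → d) ℂ) :
    workCostDephased n β H F M = ∑ w ∈ workValues n β H,
      ∑ x ∈ outcomes n H ×ˢ outcomes n H with workValue β x = w,
        ∑ y ∈ outcomes n H ×ˢ outcomes n H with workValue β y = w,
          outcomeProjector n H x.1 *
            tensorPower n F (outcomeProjector n H x.2 * M * outcomeProjector n H y.2) *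
              outcomeProjector n H y.1 := by
  simp only [workCostDephased, workProjector, Finset.sum_mul, Finset.mul_sum, mapOfChoi_sum,
    mapOfChoi_kronecker_mul_mul_kronecker]
  refine Finset.sum_congr rfl fun w _ => Finset.sum_comm

/-- The work-cost-dephased map agrees with `F^{⊗ n}` on every symmetric operator: the sum
over work values and over the labels with that work value is a sum over all labels. -/
theorem IsSymmetricOperator.workCostDephased_apply {n : ℕ} (β : ℝ) {H : Matrix d d ℂ}
    (hH : H.IsHermitian) {F : Matrix d d ℂ →ₗ[ℂ] Matrix d d ℂ} (hF : IsTimeCovariantChannel H F)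
    {M : Matrix (Fin n → d) (Fin n → d) ℂ} (hM : IsSymmetricOperator H M) :
    workCostDephased n β H F M = WorkCostDephasing.tensorPower n F M := by
  classical
  -- `F^{⊗ n}(Q M)` is again symmetric, so the outer projectors also have to agree.
  have hterm : ∀ x y : (ℝ × n.Partition) × (ℝ × n.Partition),
      outcomeProjector n H x.1 * WorkCostDephasing.tensorPower n F
        (outcomeProjector n H x.2 * M * outcomeProjector n H y.2) * outcomeProjector n H y.1 =
      if x = y then outcomeProjector n H x.1 *
        WorkCostDephasing.tensorPower n F (outcomeProjector n H x.2 * M) else 0 := by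
    intro x y
    rw [hM.outcomeProjector_mul_mul hH]
    by_cases h2 : x.2 = y.2
    · have hsymm := ((isSymmetricOperator_outcomeProjector hH x.2).mul hM).tensorPower hF
      rw [if_pos h2, hsymm.outcomeProjector_mul_mul hH]
      have hxy : x = y ↔ x.1 = y.1 := ⟨congrArg Prod.fst, fun h1 => Prod.ext h1 h2⟩
      simp only [hxy]
    · rw [if_neg h2, if_neg fun h => h2 (congrArg Prod.snd h)]
      simp
  rw [WorkCostDephasing.workCostDephased_apply]
  calc _ = ∑ w ∈ workValues n β H, ∑ x ∈ outcomes n H ×ˢ outcomes n H with workValue β x = w,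
        outcomeProjector n H x.1 *
          WorkCostDephasing.tensorPower n F (outcomeProjector n H x.2 * M) := by
        refine Finset.sum_congr rfl fun w _ => Finset.sum_congr rfl fun x hx => ?_
        simp only [hterm]
        rw [Finset.sum_ite_eq, if_pos hx]
    _ = ∑ x ∈ outcomes n H ×ˢ outcomes n H, outcomeProjector n H x.1 *
          WorkCostDephasing.tensorPower n F (outcomeProjector n H x.2 * M) :=
        Finset.sum_fiberwise_of_maps_to (fun x hx => Finset.mem_image_of_mem _ hx) _
    _ = WorkCostDephasing.tensorPower n F M := by
        simp only [Finset.sum_product, ← Finset.mul_sum, ← map_sum]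
        simp only [← Finset.sum_mul, sum_outcomeProjector n hH, one_mul]

end WorkCostDephasing

theorem mainTheorem9 {d : Type*} [Fintype d] [DecidableEq d] (n : ℕ) (β : ℝ) (hβ : 0 < β)
    (H : Matrix d d ℂ) (hH : H.IsHermitian)
    (F : Matrix d d ℂ →ₗ[ℂ] Matrix d d ℂ)
    (hF : WorkCostDephasing.IsQuantumChannel F)
    (hFcov : WorkCostDephasing.IsTimeCovariantChannel H F)
    (σ : Matrix (Fin n → d) (Fin n → d) ℂ)
    (hσ : WorkCostDephasing.IsState σ)
    (hσcov : WorkCostDephasing.IsTimeCovariantState (WorkCostDephasing.totalHamiltonian n H) σ)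
    (hσperm : WorkCostDephasing.IsPermutationInvariant σ) :
    WorkCostDephasing.workCostDephased n β H F σ = WorkCostDephasing.tensorPower n F σ :=
  WorkCostDephasing.IsSymmetricOperator.workCostDephased_apply β hH hFcov
    ⟨hσcov.commute, WorkCostDephasing.isPermutationInvariant_iff.1 hσperm⟩
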